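/- Let $(W,S)$ be a finite Coxeter system with length function $\ell$ and longest element $w_0$. For $w\in W$ let $R(w)$ be the set of reduced expressions of $w$ (words over $S$) and $D_R(w)=\{s\in S\mid \ell(ws)<\ell(w)\}$ its set of right descents. For $J\subseteq S$ let $w_J$ be the longest element of the standard parabolic subgroup $W_J=\langle J\rangle$. For $s\in S$ and $\alpha=s_1\cdots s_m\in R(w_0)$ let $e_s(\alpha)=s\,s_1\cdots\widehat{s_i}\cdots s_m$, where $i$ is the unique index for which this word (with $s_i$ omitted) is again a reduced expression of $w_0$. Let $P$ be a probability on $S$ with $P(s)>0$ for all $s\in S$. The exchange walk is the Markov chain with state set $R(w_0)$ that moves from $\alpha$ to $e_s(\alpha)$ with probability $P(s)$; let $T$ be its transition matrix, $T(\beta,\alpha)=\sum_{s:\,e_s(\alpha)=\beta}P(s)$. Put $\lambda_J=\sum_{s\in J}P(s)$ for $J\subseteq S$. **Theorem.** The exchange walk is ergodic (some power of $T$ has only strictly positive entries), and the following hold. 1. The eigenvalues of $T$ are the numbers $\lambda_J$, $J\subseteq S$, where $\lambda_J$ is counted with the (possibly zero) multiplicity $m_J$ given in 2. 2. The (algebraic)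 multiplicity contributed by $J$ is the non-negative integer $$m_J=\sum_{K\supseteq J}(-1)^{|K|-|J|}\,|R(w_Kw_0)|;$$ that is, the characteristic polynomial of $T$ is $\prod_{J\subseteq S}(x-\lambda_J)^{m_J}$, and $\mu\in\mathbb C$ is an eigenvalue of $T$ if and only if $\mu=\lambda_J$ for some $J$ with $m_J>0$. 3. The chain has a unique stationary distribution $\pi$, and for $\alpha=s_1\cdots s_m\in R(w_0)$ $$\pi(\alpha)=\prod_{i=1}^m\frac{P(s_i)}{1-\lambda_{D_R(s_1\cdots s_{i-1})}}.$$ 4. Let $m=\ell(w_0)$, $n=|S|$ and $p=\min_{s\in S}P(s)$. For $\varepsilon>0$ let $t_{mix}(\varepsilon)=\min\{k\ge 0\mid \sup_\nu\|T^k\nu-\pi\|_{TV}\le\varepsilon\}$, where $\nu$ ranges over all probability distributions on $R(w_0)$ and $\|\nu-\mu\|_{TV}=\max_{A}|\nu(A)-\mu(A)|$. Then $t_{mix}(\varepsilon)$ is finite and, for each fixed $\varepsilon$, is $O(m/p)$, and $O(mn)$ when $P$ is the uniform distribution on $S$: there is a constant $C(\varepsilon)$, depending on $\varepsilon$ only (and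 not on $(W,S)$ or $P$), with $t_{mix}(\varepsilon)\le C(\varepsilon)\,m/p$ always, and $t_{mix}(\varepsilon)\le C(\varepsilon)\,mn$ if $P$ is uniform. -/

import Mathlib

open scoped BigOperators

namespace ExchangeWalk

section Coxeter

variable {B W : Type*} [Group W] {M : CoxeterMatrix B}

/-! ### The Exchange Condition -/

/-- For words of a Coxeter system, the parity of the number of occurrences of `t` in the left
inversion sequence depends only on the element that the word represents. -/
theorem count_leftInvSeq_parity (cs : CoxeterSystem M W) [DecidableEq W] (t : W) {ω ω' : List B}
    (h : cs.wordProd ω = cs.wordProd ω') :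
    (((cs.leftInvSeq ω).count t : ℕ) : ZMod 2) = (((cs.leftInvSeq ω').count t : ℕ) : ZMod 2) := by
  classical
  let f : B → Function.End (W × ZMod 2) := fun i x =>
    (cs.simple i * x.1 * cs.simple i, x.2 + if x.1 = cs.simple i then 1 else 0)
  have hf : M.IsLiftable f := by
    intro i j
    have hba : cs.simple j * cs.simple i = (cs.simple i * cs.simple j)⁻¹ := by simp
    have comm : ∀ l : ℕ, cs.simple j * (cs.simple i * cs.simple j) ^ l =
        ((cs.simple i * cs.simple j) ^ l)⁻¹ * cs.simple j := by
      intro l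
      induction l with
      | zero => simp
      | succ l ih =>
        rw [pow_succ, ← mul_assoc, ih, ← pow_succ, pow_succ', mul_inv_rev, ← hba]
        simp [mul_assoc]
    have key : ∀ k : ℕ, ∀ x : W × ZMod 2, ((f i * f j) ^ k : Function.End (W × ZMod 2)) x =
        ((cs.simple i * cs.simple j) ^ k * x.1 * ((cs.simple i * cs.simple j) ^ k)⁻¹,
          x.2 + ∑ l ∈ Finset.range (2 * k),
            if x.1 = ((cs.simple i * cs.simple j) ^ l)⁻¹ * cs.simple j then 1 else 0) := by
      intro k
      induction k with
      | zero => intro x; simp; rfl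
      | succ k ih =>
        intro x
        have e1 : ((cs.simple i * cs.simple j) ^ k * x.1 * ((cs.simple i * cs.simple j) ^ k)⁻¹ =
            cs.simple j) ↔ x.1 = ((cs.simple i * cs.simple j) ^ (2 * k))⁻¹ * cs.simple j := by
          rw [two_mul, pow_add, mul_inv_rev, mul_assoc _ _ (cs.simple j), ← comm,
            mul_inv_eq_iff_eq_mul, eq_inv_mul_iff_mul_eq]
        have e2 : (cs.simple j * ((cs.simple i * cs.simple j) ^ k * x.1 *
            ((cs.simple i * cs.simple j) ^ k)⁻¹) * cs.simple j = cs.simple i) ↔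
            x.1 = ((cs.simple i * cs.simple j) ^ (2 * k + 1))⁻¹ * cs.simple j := by
          have e3 : ((cs.simple i * cs.simple j) ^ (2 * k + 1))⁻¹ * cs.simple j =
              ((cs.simple i * cs.simple j) ^ k)⁻¹ * (cs.simple j * cs.simple i *
                (cs.simple j * (cs.simple i * cs.simple j) ^ k)) := by
            rw [comm, hba, show 2 * k + 1 = k + (1 + k) by ring, pow_add, pow_add, pow_one]
            simp [mul_assoc]
          rw [e3, eq_inv_mul_iff_mul_eq]
          generalize (cs.simple i * cs.simple j) ^ k = r
          constructor
          · intro h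
            rw [← h]
            simp [mul_assoc]
          · intro h
            rw [h]
            simp [mul_assoc]
        rw [pow_succ', show 2 * (k + 1) = 2 * k + 1 + 1 by ring, Finset.sum_range_succ,
          Finset.sum_range_succ]
        change f i (f j (((f i * f j) ^ k : Function.End (W × ZMod 2)) x)) = _
        rw [ih]
        simp only [f, e1, e2, Prod.mk.injEq]
        refine ⟨?_, by ring⟩
        rw [pow_succ', mul_inv_rev, ← hba]
        simp only [mul_assoc]
    funext x
    rw [key, two_mul, Finset.sum_range_add]
    simp only [pow_add, cs.simple_mul_simple_pow, one_mul, CharTwo.add_self_eq_zero]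
    simp
    rfl
  let φ : W →* Function.End (W × ZMod 2) := cs.lift ⟨f, hf⟩
  have hφ : ∀ (ω : List B) (x : W × ZMod 2), φ (cs.wordProd ω) x =
      (cs.wordProd ω * x.1 * (cs.wordProd ω)⁻¹,
        x.2 + (((cs.rightInvSeq ω).count x.1 : ℕ) : ZMod 2)) := by
    intro ω
    induction ω with
    | nil => intro x; simp; rfl
    | cons i ω ih =>
      intro x
      have hi : φ (cs.simple i) = f i := cs.lift_apply_simple hf i
      rw [cs.wordProd_cons, map_mul, hi]
      change f i (φ (cs.wordProd ω) x) = _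
      rw [ih]
      have e1 : (cs.wordProd ω * x.1 * (cs.wordProd ω)⁻¹ = cs.simple i) ↔
          (cs.wordProd ω)⁻¹ * cs.simple i * cs.wordProd ω = x.1 := by
        rw [mul_inv_eq_iff_eq_mul, mul_assoc, inv_mul_eq_iff_eq_mul, eq_comm]
      simp only [f, e1, CoxeterSystem.rightInvSeq, List.count_cons, beq_iff_eq, Nat.cast_add,
        Nat.cast_ite, Nat.cast_one, Nat.cast_zero, Prod.mk.injEq]
      refine ⟨?_, by ring⟩
      simp [mul_assoc]
  have h2 : ∀ ω : List B, (((cs.leftInvSeq ω).count t : ℕ) : ZMod 2) =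
      (φ (cs.wordProd ω)⁻¹ (t, 0)).2 := by
    intro ω
    rw [← cs.wordProd_reverse, hφ, cs.rightInvSeq_reverse]
    simp
  rw [h2, h2, h]

theorem simple_mem_leftInvSeq (cs : CoxeterSystem M W) {s : B} {α : List B}
    (hd : cs.IsLeftDescent (cs.wordProd α) s) : cs.simple s ∈ cs.leftInvSeq α := by
  classical
  obtain ⟨ω, hω, hω'⟩ := cs.exists_isReduced (cs.simple s * cs.wordProd α)
  have hp : cs.wordProd α = cs.wordProd (s :: ω) := by
    rw [cs.wordProd_cons, ← hω']; simp
  have hred : cs.IsReduced (s :: ω) := by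
    have h1 : cs.length (cs.simple s * cs.wordProd α) + 1 = cs.length (cs.wordProd α) :=
      cs.isLeftDescent_iff.1 hd
    have h2 : cs.length (cs.wordProd ω) = ω.length := hω
    change cs.length (cs.wordProd (s :: ω)) = (s :: ω).length
    rw [← hp, ← h1, hω', h2, List.length_cons]
  have h3 : (cs.leftInvSeq (s :: ω)).count (cs.simple s) = 1 :=
    List.count_eq_one_of_mem hred.nodup_leftInvSeq (by simp [CoxeterSystem.leftInvSeq])
  have h4 := count_leftInvSeq_parity cs (cs.simple s) hp
  rw [h3] at h4
  by_contra hn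
  rw [List.count_eq_zero_of_not_mem hn] at h4
  simp at h4

/-- The Exchange Condition: if `α` is a reduced word for `w` and `ℓ(sw) < ℓ(w)`, there is exactly
one letter of `α` whose deletion from `sα` leaves a reduced word for `w`. -/
theorem exchange_condition (cs : CoxeterSystem M W) {w : W} {s : B} (hd : cs.IsLeftDescent w s)
    {α : List B} (hα : cs.IsReduced α ∧ cs.wordProd α = w) :
    ∃! i : Fin α.length, cs.IsReduced (s :: α.eraseIdx i) ∧
      cs.wordProd (s :: α.eraseIdx i) = w := by
  obtain ⟨hr, rfl⟩ := hα
  have hget : ∀ i : Fin α.length, cs.wordProd (α.eraseIdx i) =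
      (cs.leftInvSeq α)[(i : ℕ)]'(by simp) * cs.wordProd α := by
    intro i
    rw [← cs.getD_leftInvSeq_mul_wordProd, List.getD_eq_getElem]
  obtain ⟨i, hi, hs⟩ := List.getElem_of_mem (simple_mem_leftInvSeq cs hd)
  rw [cs.length_leftInvSeq] at hi
  have hprod : cs.wordProd (s :: α.eraseIdx i) = cs.wordProd α := by
    rw [cs.wordProd_cons, hget ⟨i, hi⟩]
    simp only [hs]
    simp
  refine ⟨⟨i, hi⟩, ⟨?_, hprod⟩, ?_⟩
  · have h1 : cs.length (cs.wordProd α) = α.length := hr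
    change cs.length (cs.wordProd (s :: α.eraseIdx i)) = (s :: α.eraseIdx i).length
    rw [hprod, h1, List.length_cons, List.length_eraseIdx_of_lt hi]
    omega
  · rintro j ⟨-, hj⟩
    rw [cs.wordProd_cons, hget j] at hj
    have h5 : (cs.leftInvSeq α)[(j : ℕ)]'(by simp) = cs.simple s := by
      have := congrArg (fun x => cs.simple s * x * (cs.wordProd α)⁻¹) hj
      simpa [← mul_assoc] using this
    ext
    exact (hr.nodup_leftInvSeq.getElem_inj_iff).1 (h5.trans hs.symm)

/-! ### Longest elements, reduced words, exchange moves -/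

/-- The standard parabolic subgroup `W_J` generated by the simple reflections in `J`. -/
def parabolic (cs : CoxeterSystem M W) (J : Finset B) : Subgroup W :=
  Subgroup.closure (cs.simple '' (J : Set B))

theorem exists_longest (cs : CoxeterSystem M W) [Finite W] (H : Subgroup W) :
    ∃ w ∈ H, ∀ v ∈ H, cs.length v ≤ cs.length w :=
  Set.exists_max_image (H : Set W) cs.length (Set.toFinite _) ⟨1, H.one_mem⟩

/-- An element of maximal length of the subgroup `H`; it is unique when `H` is a standard
parabolic subgroup, in particular when `H` is the whole group. -/
noncomputable def longest (cs : CoxeterSystem M W) [Finite W] (H : Subgroup W) : W :=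
  (exists_longest cs H).choose

/-- The longest element `w_J` of the standard parabolic subgroup `W_J`. -/
noncomputable def longestParabolic (cs : CoxeterSystem M W) [Finite W] (J : Finset B) : W :=
  longest cs (parabolic cs J)

/-- The longest element `w₀` of the finite Coxeter group `W`. -/
noncomputable def longestElement (cs : CoxeterSystem M W) [Finite W] : W :=
  longest cs ⊤

theorem isLeftDescent_longestElement (cs : CoxeterSystem M W) [Finite W] (s : B) :
    cs.IsLeftDescent (longestElement cs) s :=
  lt_of_le_of_ne ((exists_longest cs ⊤).choose_spec.2 _ (Subgroup.mem_top _))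
    (cs.length_simple_mul_ne _ _)

/-- `R(w)`, the set of reduced expressions of `w`. -/
def ReducedWord (cs : CoxeterSystem M W) (w : W) : Type _ :=
  {α : List B // cs.IsReduced α ∧ cs.wordProd α = w}

instance reducedWord_finite (cs : CoxeterSystem M W) [Finite B] (w : W) :
    Finite (ReducedWord cs w) := by
  have h : {α : List B | cs.IsReduced α ∧ cs.wordProd α = w}.Finite := by
    refine (List.finite_length_eq B (cs.length w)).subset ?_
    rintro α ⟨hα, rfl⟩
    exact hα.symm
  exact h.to_subtype

noncomputable instance reducedWordFintype (cs : CoxeterSystem M W) [Finite B] (w : W) :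
    Fintype (ReducedWord cs w) :=
  Fintype.ofFinite _

noncomputable instance reducedWordDecidableEq (cs : CoxeterSystem M W) (w : W) :
    DecidableEq (ReducedWord cs w) :=
  Classical.decEq _

/-- The exchange move `e_s`: it sends the reduced expression `s₁⋯sₘ` of `w₀` to
`s s₁⋯ŝᵢ⋯sₘ`, where `i` is the unique index for which this is a reduced expression of `w₀`. -/
noncomputable def exchange (cs : CoxeterSystem M W) [Finite W] (s : B)
    (α : ReducedWord cs (longestElement cs)) : ReducedWord cs (longestElement cs) :=
  ⟨s :: α.1.eraseIdx
      (exchange_condition cs (isLeftDescent_longestElement cs s) α.2).exists.choose,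
    (exchange_condition cs (isLeftDescent_longestElement cs s) α.2).exists.choose_spec⟩

/-- The transition matrix of the exchange walk driven by `P`, as a column stochastic matrix: the
entry `(β, α)` is the probability of a move from `α` to `β`. -/
noncomputable def transitionMatrix (cs : CoxeterSystem M W) [Finite W] [Fintype B] (P : B → ℝ) :
    Matrix (ReducedWord cs (longestElement cs)) (ReducedWord cs (longestElement cs)) ℝ :=
  fun β α => ∑ s : B, if exchange cs s α = β then P s else 0

open Classical in
/-- The set `D_R(w)` of right descents of `w`. -/
noncomputable def rightDescents (cs : CoxeterSystem M W) [Fintype B] (w : W) : Finset B :=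
  Finset.univ.filter fun s => cs.IsRightDescent w s

/-- `λ_J`, the probability that a letter drawn from `P` belongs to `J`. -/
def lam (P : B → ℝ) (J : Finset B) : ℝ := ∑ s ∈ J, P s

open Classical in
/-- `∑_{K ⊇ J} (-1)^{|K| - |J|} |R(w_K w₀)|`. -/
noncomputable def multiplicity (cs : CoxeterSystem M W) [Finite W] [Fintype B] (J : Finset B) : ℤ :=
  ∑ K : Finset B with J ⊆ K, (-1) ^ (K.card - J.card) *
    (Fintype.card (ReducedWord cs (longestParabolic cs K * longestElement cs)) : ℤ)

/-- The product `∏ᵢ P(sᵢ) / (1 - λ_{D_R(s₁⋯sᵢ₋₁)})` over the letters of `α = s₁⋯sₘ`. -/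
noncomputable def stationaryProduct (cs : CoxeterSystem M W) [Finite W] [Fintype B] (P : B → ℝ)
    (α : ReducedWord cs (longestElement cs)) : ℝ :=
  ∏ i : Fin α.1.length,
    P (α.1.get i) / (1 - lam P (rightDescents cs (cs.wordProd (α.1.take i))))

end Coxeter

section Markov

variable {Ω : Type*} [Fintype Ω] [DecidableEq Ω]

/-- The (column stochastic) matrix `T` is the transition matrix of an ergodic Markov chain. -/
def IsErgodic (T : Matrix Ω Ω ℝ) : Prop :=
  T ∈ Matrix.colStochastic ℝ Ω ∧ ∃ k : ℕ, ∀ α β, 0 < (T ^ k) α β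

/-- `π` is a probability distribution on the state space with `T π = π`. -/
def IsStationary (T : Matrix Ω Ω ℝ) (π : Ω → ℝ) : Prop :=
  π ∈ stdSimplex ℝ Ω ∧ T.mulVec π = π

/-- The total variation distance `max_A |ν(A) - μ(A)|`. -/
noncomputable def tvDist (ν μ : Ω → ℝ) : ℝ :=
  Finset.univ.sup' Finset.univ_nonempty fun A : Finset Ω => |∑ ω ∈ A, ν ω - ∑ ω ∈ A, μ ω|

/-- `d(k) = sup_ν ‖T^k ν - π‖_TV`, the supremum being over all probability distributions `ν`. -/
noncomputable def distToStationary (T : Matrix Ω Ω ℝ) (π : Ω → ℝ) (k : ℕ) : ℝ :=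
  ⨆ ν : stdSimplex ℝ Ω, tvDist ((T ^ k).mulVec ν) π

/-- The times `k` with `d(k) ≤ ε`. -/
def mixedTimes (T : Matrix Ω Ω ℝ) (π : Ω → ℝ) (ε : ℝ) : Set ℕ :=
  {k | distToStationary T π k ≤ ε}

/-- The mixing time `min {k | d(k) ≤ ε}`. -/
noncomputable def mixingTime (T : Matrix Ω Ω ℝ) (π : Ω → ℝ) (ε : ℝ) : ℕ :=
  sInf (mixedTimes T π ε)

end Markov

end ExchangeWalk

/-!
The walk is analysed through the Demazure (0-Hecke) product of words. Reading a word from left to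
right and keeping exactly the letters that increase the length of the product gives its greedy
reduced subword, `greedy cs 1 x`. The left and the right Demazure actions commute (`demR_demL`, a
consequence of the Exchange Condition), so the exchange moves along a word `x` take the reduced
expression `α` of `w₀` to the greedy reduced subword of `x ++ α` (`act_val`). Everything else
follows from this description.

*Coalescence.* Once the Demazure product of `x` is `w₀`, the result of the moves along `x` does
not depend on `α`. Appending a random letter to a word whose Demazure product is not `w₀`
increases the length of the product with probability at least `p = min P`, so `w₀` has not been
reached after `k` letters with probability at most `ℓ(w₀) / (k p)` (`mul_nonabsorption_le`). This
bounds the total variation distance to stationarity, hence the mixing time. The probability that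
the greedy subword of a random word of length `k` is `α` increases with `k`, and a first step
analysis identifies its limit with the stationary product (`tendsto_greedyProb`); so the walk
started anywhere converges to that product, which is therefore the unique stationary distribution.
Moving along the letters of `β` always leads to `β` (`act_self`), which gives ergodicity.

*Spectrum.* The powers of a word `x` have Demazure products that stabilise at `w_K`, where `K` is
the set of letters of `x`. Hence the reduced expressions fixed by `x` are those starting with one
particular reduced expression of `w_K`, and there are `|R(w_K w₀)|` of them (`card_act_eq_self`).
By Möbius inversion `tr T^k = ∑_J m_J λ_J^k` for every `k` and arbitrary real weights
(`trace_transitionMatrix_pow`). The power sums of the roots of a polynomial determine their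
multiplicities, so `μ` is a root of the characteristic polynomial with multiplicity
`∑_{λ_J = μ} m_J` (`count_roots_charpoly`). For weights for which the `λ_J` are distinct this shows that each
`m_J`, which does not depend on the weights, is a multiplicity and so non-negative.
-/

namespace ExchangeWalk

/-! ### Power sums and the characteristic polynomial -/

section LinearAlgebra

open Module

/-- The `k`-th power sum of the roots of the characteristic polynomial, counted with multiplicity,
is the trace of the `k`-th power. -/
theorem trace_pow_eq_sum_roots {K V : Type*} [Field K] [IsAlgClosed K] [AddCommGroup V]
    [Module K V] [FiniteDimensional K V] (f : End K V) (k : ℕ) :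
    LinearMap.trace K V (f ^ k) = (f.charpoly.roots.map (· ^ k)).sum := by
  classical
  have hint : DirectSum.IsInternal f.maxGenEigenspace :=
    DirectSum.isInternal_submodule_of_iSupIndep_of_iSup_eq_top
      f.independent_maxGenEigenspace f.iSup_maxGenEigenspace_eq_top
  have hmaps : ∀ k : ℕ, ∀ μ : K,
      Set.MapsTo (f ^ k : End K V) (f.maxGenEigenspace μ) (f.maxGenEigenspace μ) :=
    fun k μ => End.mapsTo_maxGenEigenspace_of_comm ((Commute.refl f).pow_right k) μ
  have hmult : ∀ μ, f.charpoly.roots.count μ = finrank K (f.maxGenEigenspace μ) := fun μ => by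
    rw [LinearMap.finrank_maxGenEigenspace_eq, Polynomial.count_roots]
  have hfin : {μ | f.maxGenEigenspace μ ≠ ⊥}.Finite := by
    refine f.charpoly.roots.toFinset.finite_toSet.subset fun μ hμ => ?_
    rw [Finset.mem_coe, Multiset.mem_toFinset, ← Multiset.count_ne_zero, hmult]
    exact fun h => hμ (Submodule.finrank_eq_zero.1 h)
  -- On the generalized eigenspace of `μ` the operator `f - μ` is nilpotent, so composing with `f`
  -- multiplies the trace by `μ`.
  have htr : ∀ μ, LinearMap.trace K _ ((f ^ k : End K V).restrict (hmaps k μ)) =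
      (f.charpoly.roots.count μ : K) * μ ^ k := by
    intro μ
    have hf1 : Set.MapsTo f (f.maxGenEigenspace μ) (f.maxGenEigenspace μ) := by
      simpa using hmaps 1 μ
    have hpow : ∀ k, (f ^ k : End K V).restrict (hmaps k μ) = (f.restrict hf1) ^ k :=
      fun k => (End.pow_restrict (f' := f) k hf1 _).symm
    rw [hpow]
    induction k with
    | zero => rw [pow_zero, pow_zero, LinearMap.trace_one, hmult, mul_one]
    | succ k ih =>
      have hn : IsNilpotent (f.restrict hf1 - algebraMap K _ μ) :=
        End.isNilpotent_restrict_maxGenEigenspace_sub_algebraMap f μ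
      rw [pow_succ, End.mul_eq_comp, LinearMap.trace_comp_eq_mul_of_commute_of_isNilpotent μ
        ((Commute.refl _).pow_left k) hn, ih]
      ring
  rw [LinearMap.trace_eq_sum_trace_restrict' hint hfin (hmaps k), Finset.sum_multiset_map_count]
  simp only [htr, nsmul_eq_mul]
  refine Finset.sum_subset (fun μ hμ => ?_) fun μ _ hμ => ?_
  · rw [Set.Finite.mem_toFinset] at hμ
    rw [Multiset.mem_toFinset, ← Multiset.count_ne_zero, hmult]
    exact fun h => hμ (Submodule.finrank_eq_zero.1 h)
  · rw [Set.Finite.mem_toFinset, Set.mem_ofPred_eq, not_not] at hμ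
    rw [hmult, Submodule.finrank_eq_zero.2 hμ, Nat.cast_zero, zero_mul]

/-- The multiplicities of a multiset, as elements of the field, are determined by its power sums.
These may be given with arbitrary, possibly cancelling, weights. -/
theorem count_eq_sum_of_power_sums {K ι : Type*} [Field K] [DecidableEq K] [Fintype ι]
    (A : Multiset K) (a : ι → K) (l : ι → K)
    (h : ∀ k : ℕ, (A.map (· ^ k)).sum = ∑ i, a i * l i ^ k) (μ : K) :
    (A.count μ : K) = ∑ i with l i = μ, a i := by
  have hq : ∀ q : Polynomial K, (A.map fun x => q.eval x).sum = ∑ i, a i * q.eval (l i) := by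
    intro q
    induction q using Polynomial.induction_on' with
    | add p q hp hq =>
      simp only [Polynomial.eval_add, Multiset.sum_map_add, hp, hq, mul_add,
        Finset.sum_add_distrib]
    | monomial k c =>
      simp only [Polynomial.eval_monomial, Multiset.sum_map_mul_left, h k, Finset.mul_sum]
      exact Finset.sum_congr rfl fun i _ => by ring
  -- `q` vanishes at every relevant point except `μ`.
  let S : Finset K := (A.toFinset ∪ Finset.univ.image l).erase μ
  let q : Polynomial K := ∏ z ∈ S, (Polynomial.X - Polynomial.C z)
  have hq0 : ∀ z ∈ S, q.eval z = 0 := fun z hz => by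
    rw [Polynomial.eval_prod]
    exact Finset.prod_eq_zero hz (by simp)
  have hqμ : q.eval μ ≠ 0 := by
    rw [Polynomial.eval_prod, Finset.prod_ne_zero_iff]
    intro z hz
    simpa [sub_eq_zero, eq_comm] using Finset.ne_of_mem_erase hz
  have h1 : (A.map fun x => q.eval x).sum = A.count μ * q.eval μ := by
    rw [Finset.sum_multiset_map_count, ← nsmul_eq_mul]
    refine Finset.sum_eq_single μ (fun z hz hne => ?_) fun hμ => ?_
    · rw [hq0 z (Finset.mem_erase.2 ⟨hne, Finset.mem_union_left _ hz⟩), smul_zero]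
    · rw [Multiset.count_eq_zero_of_notMem (by simpa using hμ), zero_smul]
  have h2 : ∑ i, a i * q.eval (l i) = (∑ i with l i = μ, a i) * q.eval μ := by
    rw [Finset.sum_mul, Finset.sum_filter]
    refine Finset.sum_congr rfl fun i _ => ?_
    split_ifs with hi
    · rw [hi]
    · rw [hq0 (l i) (Finset.mem_erase.2 ⟨hi, Finset.mem_union_right _ (by simp)⟩), mul_zero]
  exact mul_right_cancel₀ hqμ (h1 ▸ h2 ▸ hq q)

end LinearAlgebra

/-! ### Demazure products and exchange moves -/

section Demazure

variable {B W : Type*} [Group W] {M : CoxeterMatrix B}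

open Classical in
/-- The right Demazure action of a letter: `w * s` if this is longer than `w`, and `w` if not. -/
noncomputable def demR (cs : CoxeterSystem M W) (w : W) (s : B) : W :=
  if cs.IsRightDescent w s then w else w * cs.simple s

open Classical in
/-- The left Demazure action of a letter: `s * w` if this is longer than `w`, and `w` if not. -/
noncomputable def demL (cs : CoxeterSystem M W) (s : B) (w : W) : W :=
  if cs.IsLeftDescent w s then w else cs.simple s * w

/-- The right Demazure action of a word. -/
noncomputable def demazure (cs : CoxeterSystem M W) (w : W) (x : List B) : W :=
  x.foldl (demR cs) w

open Classical in
/-- The greedy reduced subword of `x` relative to `w`: the letters of `x` that, read from left to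
right, increase the length of the Demazure product started at `w`. -/
noncomputable def greedy (cs : CoxeterSystem M W) : W → List B → List B
  | _, [] => []
  | w, s :: x => if cs.IsRightDescent w s then greedy cs w x
      else s :: greedy cs (w * cs.simple s) x

variable (cs : CoxeterSystem M W)

theorem demazure_cons (w : W) (s : B) (x : List B) :
    demazure cs w (s :: x) = demazure cs (demR cs w s) x := rfl

theorem demazure_append (w : W) (x y : List B) :
    demazure cs w (x ++ y) = demazure cs (demazure cs w x) y := List.foldl_append

theorem demR_one (s : B) : demR cs 1 s = cs.simple s := by
  simp [demR, cs.not_isRightDescent_one]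

theorem demL_one (s : B) : demL cs s 1 = cs.simple s := by
  simp [demL, cs.not_isLeftDescent_one]

theorem greedy_cons_of_isRightDescent {w : W} {s : B} (h : cs.IsRightDescent w s) (x : List B) :
    greedy cs w (s :: x) = greedy cs w x := by
  simp [greedy, h]

theorem greedy_cons_of_not_isRightDescent {w : W} {s : B} (h : ¬ cs.IsRightDescent w s)
    (x : List B) : greedy cs w (s :: x) = s :: greedy cs (w * cs.simple s) x := by
  simp [greedy, h]

theorem greedy_append (w : W) (x y : List B) :
    greedy cs w (x ++ y) = greedy cs w x ++ greedy cs (demazure cs w x) y := by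
  induction x generalizing w with
  | nil => rfl
  | cons s x ih =>
    rw [List.cons_append, demazure_cons]
    by_cases h : cs.IsRightDescent w s
    · rw [greedy_cons_of_isRightDescent cs h, greedy_cons_of_isRightDescent cs h, ih, demR,
        if_pos h]
    · rw [greedy_cons_of_not_isRightDescent cs h, greedy_cons_of_not_isRightDescent cs h, ih,
        demR, if_neg h, List.cons_append]

theorem mul_wordProd_greedy (w : W) (x : List B) :
    w * cs.wordProd (greedy cs w x) = demazure cs w x := by
  induction x generalizing w with
  | nil => simp [greedy, demazure]
  | cons s x ih =>
    rw [demazure_cons, demR]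
    split_ifs with h
    · rw [greedy_cons_of_isRightDescent cs h, ih]
    · rw [greedy_cons_of_not_isRightDescent cs h, cs.wordProd_cons, ← mul_assoc, ih]

theorem length_demazure (w : W) (x : List B) :
    cs.length (demazure cs w x) = cs.length w + (greedy cs w x).length := by
  induction x generalizing w with
  | nil => simp [greedy, demazure]
  | cons s x ih =>
    rw [demazure_cons, demR]
    split_ifs with h
    · rw [greedy_cons_of_isRightDescent cs h, ih]
    · rw [greedy_cons_of_not_isRightDescent cs h, ih, cs.not_isRightDescent_iff.1 h,
        List.length_cons]
      ring

theorem wordProd_greedy_one (x : List B) :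
    cs.wordProd (greedy cs 1 x) = demazure cs 1 x := by
  rw [← mul_wordProd_greedy, one_mul]

theorem isReduced_greedy_one (x : List B) : cs.IsReduced (greedy cs 1 x) := by
  have := length_demazure cs 1 x
  rwa [cs.length_one, zero_add, ← wordProd_greedy_one] at this

theorem length_mul_simple_of_reduced {w : W} {s : B} {β : List B}
    (h : cs.length (w * cs.wordProd (s :: β)) = cs.length w + (s :: β).length) :
    ¬ cs.IsRightDescent w s ∧ cs.length (w * cs.simple s * cs.wordProd β) =
      cs.length (w * cs.simple s) + β.length := by
  rw [cs.wordProd_cons, ← mul_assoc, List.length_cons] at h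
  have h1 := cs.length_mul_le (w * cs.simple s) (cs.wordProd β)
  have h2 := cs.length_wordProd_le β
  have h3 := cs.length_mul_simple w s
  rw [cs.not_isRightDescent_iff]
  omega

theorem greedy_eq_self {w : W} {β : List B}
    (h : cs.length (w * cs.wordProd β) = cs.length w + β.length) : greedy cs w β = β := by
  induction β generalizing w with
  | nil => rfl
  | cons s β ih =>
    obtain ⟨h1, h2⟩ := length_mul_simple_of_reduced cs h
    rw [greedy_cons_of_not_isRightDescent cs h1, ih h2]

theorem greedy_eq_nil_iff {w : W} {x : List B} :
    greedy cs w x = [] ↔ ∀ s ∈ x, cs.IsRightDescent w s := by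
  induction x with
  | nil => simp [greedy]
  | cons s x ih =>
    by_cases h : cs.IsRightDescent w s
    · simp [greedy_cons_of_isRightDescent cs h, ih, h]
    · simp [greedy_cons_of_not_isRightDescent cs h, h]

theorem demazure_eq_self {w : W} {x : List B} (h : ∀ s ∈ x, cs.IsRightDescent w s) :
    demazure cs w x = w := by
  rw [← mul_wordProd_greedy, (greedy_eq_nil_iff cs).2 h, cs.wordProd_nil, mul_one]

theorem mem_of_mem_greedy {w : W} {x : List B} {s : B} (h : s ∈ greedy cs w x) : s ∈ x := by
  induction x generalizing w with
  | nil => simp [greedy] at h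
  | cons t x ih =>
    by_cases ht : cs.IsRightDescent w t
    · rw [greedy_cons_of_isRightDescent cs ht] at h
      exact List.mem_cons_of_mem _ (ih h)
    · rw [greedy_cons_of_not_isRightDescent cs ht, List.mem_cons] at h
      rcases h with rfl | h
      · exact List.mem_cons_self
      · exact List.mem_cons_of_mem _ (ih h)

/-- The lifting property: if `sw` and `wt` are longer than `w` but `swt` is not longer than `sw`,
then `sw = wt`. -/
theorem simple_mul_eq_mul_simple {w : W} {s t : B} (hs : ¬ cs.IsLeftDescent w s)
    (ht : ¬ cs.IsRightDescent w t) (h : cs.IsRightDescent (cs.simple s * w) t) :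
    cs.simple s * w = w * cs.simple t := by
  rw [cs.not_isLeftDescent_iff] at hs
  rw [cs.not_isRightDescent_iff] at ht
  obtain ⟨α, hα, rfl⟩ := cs.exists_isReduced w
  have hα' := hα.eq
  have hd : cs.IsLeftDescent (cs.wordProd α * cs.simple t) s := by
    rw [CoxeterSystem.IsLeftDescent, ← mul_assoc]
    rw [CoxeterSystem.IsRightDescent] at h
    omega
  have hp : cs.wordProd (α ++ [t]) = cs.wordProd α * cs.simple t := by
    rw [cs.wordProd_append, cs.wordProd_singleton]
  have hred : cs.IsReduced (α ++ [t]) := by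
    rw [CoxeterSystem.IsReduced, hp, ht, hα', List.length_append, List.length_singleton]
  obtain ⟨i, ⟨-, hi⟩, -⟩ := exchange_condition cs hd ⟨hred, hp⟩
  rw [cs.wordProd_cons] at hi
  -- The deleted letter is the final `t`: deleting one of `α` would make `sw` shorter than `w`.
  rcases lt_or_ge (i : ℕ) α.length with hlt | hge
  · exfalso
    rw [List.eraseIdx_append_of_lt_length hlt, cs.wordProd_append, cs.wordProd_singleton,
      ← mul_assoc, mul_left_inj] at hi
    have h1 := cs.length_wordProd_le (α.eraseIdx i)
    rw [List.length_eraseIdx_of_lt hlt] at h1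
    have h2 : cs.wordProd (α.eraseIdx i) = cs.simple s * cs.wordProd α := by rw [← hi]; simp
    rw [h2] at h1
    omega
  · rw [List.eraseIdx_append_of_length_le hge] at hi
    have : (i : ℕ) - α.length = 0 := by have := i.2; simp at this; omega
    rwa [this, List.eraseIdx_cons_zero, List.append_nil] at hi

theorem isLeftDescent_mul_simple {w : W} {s t : B} (hs : cs.IsLeftDescent w s)
    (ht : ¬ cs.IsRightDescent w t) : cs.IsLeftDescent (w * cs.simple t) s := by
  rw [cs.not_isRightDescent_iff] at ht
  rw [CoxeterSystem.IsLeftDescent] at hs ⊢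
  have := cs.length_mul_le (cs.simple s * w) (cs.simple t)
  rw [cs.length_simple, mul_assoc] at this
  omega

theorem isRightDescent_simple_mul {w : W} {s t : B} (hs : ¬ cs.IsLeftDescent w s)
    (ht : cs.IsRightDescent w t) : cs.IsRightDescent (cs.simple s * w) t := by
  rw [cs.not_isLeftDescent_iff] at hs
  rw [CoxeterSystem.IsRightDescent] at ht ⊢
  have := cs.length_mul_le (cs.simple s) (w * cs.simple t)
  rw [cs.length_simple, ← mul_assoc] at this
  omega

theorem isRightDescent_demL {w : W} {s t : B} (ht : cs.IsRightDescent w t) :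
    cs.IsRightDescent (demL cs s w) t := by
  rw [demL]
  split_ifs with hs
  · exact ht
  · exact isRightDescent_simple_mul cs hs ht

theorem demR_demL (w : W) (s t : B) : demR cs (demL cs s w) t = demL cs s (demR cs w t) := by
  by_cases ht : cs.IsRightDescent w t
  · rw [demR, if_pos (isRightDescent_demL cs ht), demR, if_pos ht]
  by_cases hs : cs.IsLeftDescent w s
  · rw [demL, if_pos hs, demR, if_neg ht, demL, if_pos (isLeftDescent_mul_simple cs hs ht)]
  rw [demL, if_neg hs, demR, demR, if_neg ht, demL]
  have hs' := cs.not_isLeftDescent_iff.1 hs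
  have ht' := cs.not_isRightDescent_iff.1 ht
  split_ifs with h1 h2 h2
  · exact simple_mul_eq_mul_simple cs hs ht h1
  · refine absurd ?_ h2
    rw [CoxeterSystem.IsLeftDescent, ← mul_assoc]
    rw [CoxeterSystem.IsRightDescent] at h1
    omega
  · refine absurd ?_ h1
    rw [CoxeterSystem.IsLeftDescent, ← mul_assoc] at h2
    rw [CoxeterSystem.IsRightDescent]
    omega
  · rw [mul_assoc]

theorem demazure_demL (w : W) (s : B) (x : List B) :
    demazure cs (demL cs s w) x = demL cs s (demazure cs w x) := by
  induction x generalizing w with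
  | nil => rfl
  | cons t x ih => rw [demazure_cons, demR_demL, ih, demazure_cons]

theorem demazure_one_cons (s : B) (x : List B) :
    demazure cs 1 (s :: x) = demL cs s (demazure cs 1 x) := by
  rw [demazure_cons, demR_one, ← demL_one, demazure_demL]

/-- Letters dropped by the greedy reduction relative to `w` would be dropped relative to the left
Demazure product of `s` and `w` as well. -/
theorem greedy_demL_greedy (w : W) (s : B) (x : List B) :
    greedy cs (demL cs s w) (greedy cs w x) = greedy cs (demL cs s w) x := by
  induction x generalizing w with
  | nil => rfl
  | cons t x ih =>
    by_cases ht : cs.IsRightDescent w t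
    · rw [greedy_cons_of_isRightDescent cs ht,
        greedy_cons_of_isRightDescent cs (isRightDescent_demL cs ht), ih]
    · have hcomm := demR_demL cs w s t
      have ih' := ih (w * cs.simple t)
      rw [demR, demR, if_neg ht] at hcomm
      rw [greedy_cons_of_not_isRightDescent cs ht]
      by_cases h : cs.IsRightDescent (demL cs s w) t
      · rw [if_pos h] at hcomm
        rw [greedy_cons_of_isRightDescent cs h, greedy_cons_of_isRightDescent cs h, hcomm, ih']
      · rw [if_neg h] at hcomm
        rw [greedy_cons_of_not_isRightDescent cs h, greedy_cons_of_not_isRightDescent cs h, hcomm,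
          ih']

/-- Prepending `s` makes the greedy reduction drop exactly one letter of `β`: the one at which `s`
becomes redundant. -/
theorem exists_greedy_eq_eraseIdx {w : W} {s : B} {β : List B} (hs : ¬ cs.IsLeftDescent w s)
    (hβ : cs.length (w * cs.wordProd β) = cs.length w + β.length)
    (hd : cs.IsLeftDescent (w * cs.wordProd β) s) :
    ∃ i < β.length, greedy cs (cs.simple s * w) β = β.eraseIdx i ∧
      cs.simple s * w * cs.wordProd (β.eraseIdx i) = w * cs.wordProd β := by
  induction β generalizing w with
  | nil => simp at hd; exact absurd hd hs
  | cons t β ih =>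
    obtain ⟨h1, h2⟩ := length_mul_simple_of_reduced cs hβ
    have hs' := cs.not_isLeftDescent_iff.1 hs
    have h1' := cs.not_isRightDescent_iff.1 h1
    rw [cs.wordProd_cons, ← mul_assoc] at hd ⊢
    by_cases h : cs.IsRightDescent (cs.simple s * w) t
    · have he := simple_mul_eq_mul_simple cs hs h1 h
      refine ⟨0, by simp, ?_, ?_⟩
      · rw [greedy_cons_of_isRightDescent cs h, he, greedy_eq_self cs h2, List.eraseIdx_cons_zero]
      · rw [List.eraseIdx_cons_zero, he]
    · have h' := cs.not_isRightDescent_iff.1 h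
      have h3 : ¬ cs.IsLeftDescent (w * cs.simple t) s := by
        rw [CoxeterSystem.IsLeftDescent, ← mul_assoc]
        omega
      obtain ⟨i, hi, h4, h5⟩ := ih h3 h2 hd
      refine ⟨i + 1, by simpa using hi, ?_, ?_⟩
      · rw [greedy_cons_of_not_isRightDescent cs h, List.eraseIdx_cons_succ, mul_assoc, h4]
      · rw [List.eraseIdx_cons_succ, cs.wordProd_cons, ← h5]
        simp only [mul_assoc]

theorem exchange_val [Finite W] (s : B) (α : ReducedWord cs (longestElement cs)) :
    (exchange cs s α).1 = s :: greedy cs (cs.simple s) α.1 := by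
  have hα := α.2.1.eq
  obtain ⟨i, hi, h1, h2⟩ := exists_greedy_eq_eraseIdx cs (w := 1) (s := s) (β := α.1)
    (cs.not_isLeftDescent_one s) (by simpa using hα)
    (by rw [one_mul, α.2.2]; exact isLeftDescent_longestElement cs s)
  rw [mul_one, one_mul, ← cs.wordProd_cons] at h2
  rw [mul_one] at h1
  have hu := exchange_condition cs (isLeftDescent_longestElement cs s) α.2
  have hp : cs.wordProd (s :: α.1.eraseIdx i) = longestElement cs := by rw [h2, α.2.2]
  have : hu.exists.choose = ⟨i, hi⟩ := by
    refine hu.unique hu.exists.choose_spec ⟨?_, hp⟩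
    rw [CoxeterSystem.IsReduced, h2, hα, List.length_cons, List.length_eraseIdx_of_lt hi]
    omega
  rw [h1]
  change s :: α.1.eraseIdx hu.exists.choose = _
  rw [this]

/-- The composite of the exchange moves of the letters of a word; the last letter moves first. -/
noncomputable def act [Finite W] (x : List B) (α : ReducedWord cs (longestElement cs)) :
    ReducedWord cs (longestElement cs) :=
  x.foldr (exchange cs) α

theorem act_cons [Finite W] (s : B) (x : List B) (α : ReducedWord cs (longestElement cs)) :
    act cs (s :: x) α = exchange cs s (act cs x α) := rfl

/-- The exchange moves along `x` take `α` to the greedy reduced subword of `x ++ α`. -/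
theorem act_val [Finite W] (x : List B) (α : ReducedWord cs (longestElement cs)) :
    (act cs x α).1 = greedy cs 1 (x ++ α.1) := by
  induction x with
  | nil =>
    refine (greedy_eq_self cs ?_).symm
    rw [one_mul, cs.length_one, zero_add]
    exact α.2.1.eq
  | cons s x ih =>
    have h := greedy_demL_greedy cs 1 s (x ++ α.1)
    rw [demL_one] at h
    rw [act_cons, exchange_val, ih, h, List.cons_append,
      greedy_cons_of_not_isRightDescent cs (cs.not_isRightDescent_one s), one_mul]

end Demazure

/-! ### Parabolic subgroups and fixed points of words -/

section Parabolic

variable {B W : Type*} [Group W] {M : CoxeterMatrix B} (cs : CoxeterSystem M W)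

theorem reducedWord_ext {w : W} {α β : ReducedWord cs w} (h : α.1 = β.1) : α = β := Subtype.ext h

theorem nonempty_reducedWord (w : W) : Nonempty (ReducedWord cs w) := by
  obtain ⟨z, hz, hzw⟩ := cs.exists_isReduced w
  exact ⟨⟨z, hz, hzw.symm⟩⟩

theorem exists_isReduced_of_mem_parabolic {K : Finset B} {v : W} (hv : v ∈ parabolic cs K) :
    ∃ y : List B, cs.IsReduced y ∧ cs.wordProd y = v ∧ ∀ s ∈ y, s ∈ K := by
  have step : ∀ s ∈ K, ∀ v : W,
      (∃ y : List B, cs.IsReduced y ∧ cs.wordProd y = v ∧ ∀ s ∈ y, s ∈ K) →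
      ∃ y : List B, cs.IsReduced y ∧ cs.wordProd y = cs.simple s * v ∧ ∀ s ∈ y, s ∈ K := by
    rintro s hs v ⟨y, hy, rfl, hyK⟩
    by_cases hd : cs.IsLeftDescent (cs.wordProd y) s
    · obtain ⟨i, ⟨hr, hi⟩, -⟩ := exchange_condition cs hd ⟨hy, rfl⟩
      refine ⟨y.eraseIdx i, by simpa using hr.drop 1, ?_, fun t ht =>
        hyK t (List.mem_of_mem_eraseIdx ht)⟩
      rw [← hi, cs.wordProd_cons, cs.simple_mul_simple_cancel_left]
    · refine ⟨s :: y, ?_, cs.wordProd_cons s y, ?_⟩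
      · rw [CoxeterSystem.IsReduced, cs.wordProd_cons, cs.not_isLeftDescent_iff.1 hd, hy.eq,
          List.length_cons]
      · simpa [hs] using hyK
  induction hv using Subgroup.closure_induction_left with
  | one => exact ⟨[], by simp [CoxeterSystem.IsReduced], cs.wordProd_nil, by simp⟩
  | mul_left x hx v _ ih =>
    obtain ⟨s, hs, rfl⟩ := hx
    exact step s hs v ih
  | inv_mul_cancel x hx v _ ih =>
    obtain ⟨s, hs, rfl⟩ := hx
    rw [cs.inv_simple]
    exact step s hs v ih

theorem demazure_one_append_of_isLeftDescent {y z : List B}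
    (h : ∀ s ∈ y, cs.IsLeftDescent (demazure cs 1 z) s) :
    demazure cs 1 (y ++ z) = demazure cs 1 z := by
  induction y with
  | nil => rfl
  | cons s y ih =>
    rw [List.cons_append, demazure_one_cons, ih fun t ht => h t (List.mem_cons_of_mem _ ht), demL,
      if_pos (h s List.mem_cons_self)]

theorem demazure_one_of_isReduced {y : List B} (hy : cs.IsReduced y) :
    demazure cs 1 y = cs.wordProd y := by
  rw [← wordProd_greedy_one, greedy_eq_self]
  simpa using hy.eq

/-- Uniqueness of the longest element, with `K` playing the role of the generating set: the
Demazure product of `y ++ z` equals the product of `y` by the right descents of the latter, and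
the product of `z` by its left descents. -/
theorem wordProd_eq_of_isDescent {K : Set B} {y z : List B} (hy : cs.IsReduced y)
    (hz : cs.IsReduced z) (hyK : ∀ s ∈ y, s ∈ K) (hzK : ∀ s ∈ z, s ∈ K)
    (hr : ∀ s ∈ K, cs.IsRightDescent (cs.wordProd y) s)
    (hl : ∀ s ∈ K, cs.IsLeftDescent (cs.wordProd z) s) : cs.wordProd y = cs.wordProd z := by
  have h1 : demazure cs 1 (y ++ z) = cs.wordProd y := by
    rw [demazure_append, demazure_one_of_isReduced cs hy,
      demazure_eq_self cs fun s hs => hr s (hzK s hs)]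
  rw [← h1, ← demazure_one_of_isReduced cs hz] at *
  exact demazure_one_append_of_isLeftDescent cs fun s hs => hl s (hyK s hs)

variable [Finite W]

theorem isLeftDescent_longestParabolic {K : Finset B} {s : B} (hs : s ∈ K) :
    cs.IsLeftDescent (longestParabolic cs K) s := by
  obtain ⟨h1, h2⟩ := (exists_longest cs (parabolic cs K)).choose_spec
  exact lt_of_le_of_ne (h2 _ (mul_mem (Subgroup.subset_closure ⟨s, hs, rfl⟩) h1))
    (cs.length_simple_mul_ne _ _)

theorem exists_isReduced_longestParabolic (K : Finset B) : ∃ y : List B, cs.IsReduced y ∧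
    cs.wordProd y = longestParabolic cs K ∧ ∀ s ∈ y, s ∈ K :=
  exists_isReduced_of_mem_parabolic cs (exists_longest cs (parabolic cs K)).choose_spec.1

theorem wordProd_eq_longestParabolic {K : Finset B} {y : List B} (hy : cs.IsReduced y)
    (hyK : ∀ s ∈ y, s ∈ K) (hr : ∀ s ∈ K, cs.IsRightDescent (cs.wordProd y) s) :
    cs.wordProd y = longestParabolic cs K := by
  obtain ⟨z, hz, hzp, hzK⟩ := exists_isReduced_longestParabolic cs K
  rw [← hzp]
  refine wordProd_eq_of_isDescent cs (K := K) hy hz hyK hzK hr ?_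
  rw [hzp]
  exact fun s hs => isLeftDescent_longestParabolic cs hs

theorem longestParabolic_inv (K : Finset B) :
    (longestParabolic cs K)⁻¹ = longestParabolic cs K := by
  obtain ⟨z, hz, hzp, hzK⟩ := exists_isReduced_longestParabolic cs K
  have h : cs.wordProd z.reverse = (longestParabolic cs K)⁻¹ := by rw [cs.wordProd_reverse, hzp]
  rw [← h]
  refine wordProd_eq_longestParabolic cs hz.reverse (by simpa using hzK) fun s hs => ?_
  rw [h, cs.isRightDescent_inv_iff]
  exact isLeftDescent_longestParabolic cs hs

theorem eq_longestElement {w : W} (h : ∀ s, cs.IsRightDescent w s) : w = longestElement cs := by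
  obtain ⟨y, hy, rfl⟩ := cs.exists_isReduced w
  obtain ⟨z, hz, hzw⟩ := cs.exists_isReduced (longestElement cs)
  rw [hzw]
  refine wordProd_eq_of_isDescent cs (K := Set.univ) hy hz (by simp) (by simp) (fun s _ => h s) ?_
  rw [← hzw]
  exact fun s _ => isLeftDescent_longestElement cs s

theorem length_le_longestElement (w : W) : cs.length w ≤ cs.length (longestElement cs) :=
  (exists_longest cs ⊤).choose_spec.2 _ (Subgroup.mem_top _)

theorem isRightDescent_longestElement (s : B) : cs.IsRightDescent (longestElement cs) s :=
  lt_of_le_of_ne (length_le_longestElement cs _) (cs.length_mul_simple_ne _ _)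

theorem act_of_demazure_eq {x : List B} (hx : demazure cs 1 x = longestElement cs)
    (α : ReducedWord cs (longestElement cs)) : (act cs x α).1 = greedy cs 1 x := by
  rw [act_val, greedy_append, hx,
    (greedy_eq_nil_iff cs).2 fun s _ => isRightDescent_longestElement cs s, List.append_nil]

theorem act_append (x y : List B) (α : ReducedWord cs (longestElement cs)) :
    act cs (x ++ y) α = act cs x (act cs y α) := List.foldr_append

theorem act_self (β α : ReducedWord cs (longestElement cs)) : act cs β.1 α = β := by
  refine reducedWord_ext cs ?_
  have h : cs.length (1 * cs.wordProd β.1) = cs.length 1 + β.1.length := by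
    simpa using β.2.1.eq
  rw [act_of_demazure_eq, greedy_eq_self cs h]
  rw [demazure_one_of_isReduced cs β.2.1, β.2.2]

/-- The concatenation of `N` copies of a word. -/
def wordPow (x : List B) (N : ℕ) : List B := (List.replicate N x).flatten

theorem wordPow_succ (x : List B) (N : ℕ) : wordPow x (N + 1) = x ++ wordPow x N := by
  simp [wordPow, List.replicate_succ]

theorem wordPow_succ' (x : List B) (N : ℕ) : wordPow x (N + 1) = wordPow x N ++ x := by
  simp [wordPow, List.replicate_succ']

theorem exists_isRightDescent_demazure_wordPow (x : List B) :
    ∃ N, ∀ s ∈ x, cs.IsRightDescent (demazure cs 1 (wordPow x N)) s := by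
  -- Otherwise each further copy of `x` would increase the length of the Demazure product.
  by_contra! h
  have hlen : ∀ N, N ≤ cs.length (demazure cs 1 (wordPow x N)) := by
    intro N
    induction N with
    | zero => exact Nat.zero_le _
    | succ N ih =>
      rw [wordPow_succ', demazure_append, length_demazure]
      have : greedy cs (demazure cs 1 (wordPow x N)) x ≠ [] := by
        rw [Ne, greedy_eq_nil_iff]
        push Not
        exact h N
      have := List.length_pos_of_ne_nil this
      omega
  have := hlen (cs.length (longestElement cs) + 1)
  have := length_le_longestElement cs
    (demazure cs 1 (wordPow x (cs.length (longestElement cs) + 1)))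
  omega

open Classical in
/-- The exchange moves along `x` fix exactly the reduced expressions that start with `y`, the
greedy reduced subword of a power of `x` whose Demazure product has all letters of `x` as right
descents. -/
theorem exists_act_eq_self_iff (x : List B) :
    ∃ y : List B, cs.IsReduced y ∧ cs.wordProd y = longestParabolic cs x.toFinset ∧
      (∃ α : ReducedWord cs (longestElement cs), y <+: α.1) ∧
      ∀ α : ReducedWord cs (longestElement cs), act cs x α = α ↔ y <+: α.1 := by
  obtain ⟨N, hN⟩ := exists_isRightDescent_demazure_wordPow cs x
  set u := demazure cs 1 (wordPow x N) with hu
  have hmem : ∀ s ∈ greedy cs 1 (wordPow x N), s ∈ x := by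
    intro s hs
    have := mem_of_mem_greedy cs hs
    simp only [wordPow, List.mem_flatten, List.mem_replicate] at this
    obtain ⟨l, ⟨-, rfl⟩, h⟩ := this
    exact h
  have hpow : ∀ α, (act cs (wordPow x N) α).1 =
      greedy cs 1 (wordPow x N) ++ greedy cs u α.1 := fun α => by
    rw [act_val, greedy_append]
  obtain ⟨α₀⟩ := nonempty_reducedWord cs (longestElement cs)
  refine ⟨greedy cs 1 (wordPow x N), isReduced_greedy_one cs _, ?_,
    ⟨act cs (wordPow x N) α₀, hpow _ ▸ List.prefix_append _ _⟩, fun α => ⟨?_, ?_⟩⟩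
  · refine wordProd_eq_longestParabolic cs (isReduced_greedy_one cs _) (by simpa using hmem) ?_
    intro s hs
    rw [wordProd_greedy_one]
    exact hN s (by simpa using hs)
  · intro h
    have hfix : ∀ n, act cs (wordPow x n) α = α := by
      intro n
      induction n with
      | zero => rfl
      | succ n ih => rw [wordPow_succ, act_append, ih, h]
    rw [← hfix N, hpow]
    exact List.prefix_append _ _
  · -- Both the `N`-th and the `(N + 1)`-st power of `x` fix `α`, hence so does `x`.
    rintro ⟨β, hβ⟩
    have h1 : act cs (wordPow x N) α = α := by
      refine reducedWord_ext cs ?_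
      rw [hpow, ← hβ, greedy_append,
        (greedy_eq_nil_iff cs).2 fun s hs => hN s (hmem s hs),
        demazure_eq_self cs fun s hs => hN s (hmem s hs), List.nil_append,
        greedy_eq_self cs (w := u) (β := β)]
      have h2 := α.2.1.eq
      rw [← hβ, cs.wordProd_append, wordProd_greedy_one, List.length_append] at h2
      have h3 := length_demazure cs 1 (wordPow x N)
      rw [cs.length_one, zero_add] at h3
      rw [h2, ← h3]
    have h2 : act cs (wordPow x (N + 1)) α = α := by
      refine Eq.trans (reducedWord_ext cs ?_) h1
      rw [hpow, act_val, wordPow_succ', List.append_assoc, greedy_append, greedy_append, ← hu,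
        (greedy_eq_nil_iff cs).2 hN, demazure_eq_self cs hN, List.nil_append]
    rw [wordPow_succ, act_append, h1] at h2
    exact h2

open Classical in
theorem card_act_eq_self [Fintype B] (x : List B) :
    (Finset.univ.filter fun α : ReducedWord cs (longestElement cs) => act cs x α = α).card =
      Fintype.card (ReducedWord cs (longestParabolic cs x.toFinset * longestElement cs)) := by
  obtain ⟨y, hy, hyp, ⟨α₀, β₀, h₀⟩, hfix⟩ := exists_act_eq_self_iff cs x
  have hprod : ∀ β : List B, cs.wordProd (y ++ β) = longestElement cs ↔
      cs.wordProd β = longestParabolic cs x.toFinset * longestElement cs := fun β => by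
    rw [cs.wordProd_append, hyp, ← eq_inv_mul_iff_mul_eq, longestParabolic_inv]
  -- The reduced expression `y ++ β₀` shows that `ℓ(w_K w₀) = ℓ(w₀) - ℓ(w_K)`.
  have hred : ∀ β : List B, cs.wordProd (y ++ β) = longestElement cs →
      (cs.IsReduced (y ++ β) ↔ cs.IsReduced β) := fun β hβ => by
    have hr : cs.IsReduced β₀ := by
      have := α₀.2.1.drop y.length
      rwa [← h₀, List.drop_left] at this
    have h1 := (hprod β).1 hβ
    have h2 := (hprod β₀).1 (h₀ ▸ α₀.2.2)
    have h3 := α₀.2.1.eq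
    rw [α₀.2.2, ← h₀, List.length_append] at h3
    have h4 := hr.eq
    rw [CoxeterSystem.IsReduced, CoxeterSystem.IsReduced, hβ, h1, ← h2, List.length_append]
    omega
  rw [← Finset.card_univ]
  symm
  refine Finset.card_bij (fun β _ => ⟨y ++ β.1, ?_⟩) (fun β _ => ?_) (fun β _ γ _ h => ?_) ?_
  · have h := (hprod β.1).2 β.2.2
    exact ⟨(hred β.1 h).2 β.2.1, h⟩
  · exact Finset.mem_filter.2 ⟨Finset.mem_univ _, (hfix _).2 (List.prefix_append _ _)⟩
  · exact reducedWord_ext cs (List.append_cancel_left (congrArg Subtype.val h))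
  · intro α hα
    rw [Finset.mem_filter, hfix] at hα
    obtain ⟨-, β, hβ⟩ := hα
    have hα2 := α.2
    rw [← hβ] at hα2
    exact ⟨⟨β, (hred β hα2.2).1 hα2.1, (hprod β).1 hα2.2⟩, Finset.mem_univ _,
      reducedWord_ext cs hβ⟩

end Parabolic

/-! ### Random words and powers of the transition matrix -/

section Expectation

variable {B : Type*} [Fintype B]

/-- The expectation of `f` at a word of `k` independent letters drawn from `P`. The weights `P` may
be arbitrary real numbers. -/
noncomputable def expect (P : B → ℝ) : ℕ → (List B → ℝ) → ℝ
  | 0, f => f []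
  | k + 1, f => ∑ s, P s * expect P k fun x => f (s :: x)

variable (P : B → ℝ)

theorem expect_zero (f : List B → ℝ) : expect P 0 f = f [] := rfl

theorem expect_succ (k : ℕ) (f : List B → ℝ) :
    expect P (k + 1) f = ∑ s, P s * expect P k fun x => f (s :: x) := rfl

theorem expect_sum {ι : Type*} (t : Finset ι) (k : ℕ) (f : ι → List B → ℝ) :
    (expect P k fun x => ∑ i ∈ t, f i x) = ∑ i ∈ t, expect P k (f i) := by
  induction k generalizing f with
  | zero => rfl
  | succ k ih =>
    simp only [expect_succ, ih, Finset.mul_sum]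
    exact Finset.sum_comm

theorem expect_const_mul (c : ℝ) (k : ℕ) (f : List B → ℝ) :
    (expect P k fun x => c * f x) = c * expect P k f := by
  induction k generalizing f with
  | zero => rfl
  | succ k ih =>
    simp only [expect_succ, ih, Finset.mul_sum]
    exact Finset.sum_congr rfl fun s _ => by ring

theorem expect_sub (k : ℕ) (f g : List B → ℝ) :
    (expect P k fun x => f x - g x) = expect P k f - expect P k g := by
  induction k generalizing f g with
  | zero => rfl
  | succ k ih => simp only [expect_succ, ih, mul_sub, Finset.sum_sub_distrib]

variable {P}

theorem expect_mono (hP : ∀ s, 0 ≤ P s) {k : ℕ} {f g : List B → ℝ} (h : ∀ x, f x ≤ g x) :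
    expect P k f ≤ expect P k g := by
  induction k generalizing f g with
  | zero => exact h []
  | succ k ih =>
    exact Finset.sum_le_sum fun s _ => mul_le_mul_of_nonneg_left (ih fun x => h _) (hP s)

theorem expect_const (hP1 : ∑ s, P s = 1) (c : ℝ) (k : ℕ) : (expect P k fun _ => c) = c := by
  induction k with
  | zero => rfl
  | succ k ih => rw [expect_succ, ih, ← Finset.sum_mul, hP1, one_mul]

theorem expect_const_zero (k : ℕ) : (expect P k fun _ => (0 : ℝ)) = 0 := by
  simpa using expect_const_mul P 0 k fun _ => 0

theorem nonempty_of_sum_eq_one (hP1 : ∑ s, P s = 1) : Nonempty B := by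
  by_contra h
  rw [not_nonempty_iff] at h
  simp at hP1

theorem expect_nonneg (hP : ∀ s, 0 ≤ P s) {k : ℕ} {f : List B → ℝ} (h : ∀ x, 0 ≤ f x) :
    0 ≤ expect P k f := by
  induction k generalizing f with
  | zero => exact h []
  | succ k ih => exact Finset.sum_nonneg fun s _ => mul_nonneg (hP s) (ih fun x => h _)

theorem expect_pos (hP : ∀ s, 0 < P s) {f : List B → ℝ} (h : ∀ x, 0 ≤ f x) {x : List B}
    (hx : 0 < f x) : 0 < expect P x.length f := by
  induction x generalizing f with
  | nil => exact hx
  | cons s x ih =>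
    refine Finset.sum_pos' (fun t _ => mul_nonneg (hP t).le
      (expect_nonneg (fun s => (hP s).le) fun y => h _)) ⟨s, Finset.mem_univ s, ?_⟩
    exact mul_pos (hP s) (ih (fun y => h _) hx)

theorem abs_expect_sub_le (hP : ∀ s, 0 ≤ P s) {k : ℕ} {f g u : List B → ℝ}
    (h : ∀ x, |f x - g x| ≤ u x) : |expect P k f - expect P k g| ≤ expect P k u := by
  rw [← expect_sub, abs_le]
  constructor
  · have := expect_mono (k := k) hP fun x => (abs_le.1 (h x)).1
    calc _ = expect P k fun x => (-1) * u x := by rw [expect_const_mul]; ring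
      _ ≤ _ := by simpa using this
  · exact expect_mono hP fun x => (abs_le.1 (h x)).2

open Classical in
/-- The word consists of letters of `J` exactly if each letter does. -/
theorem expect_toFinset_subset (J : Finset B) (k : ℕ) :
    (expect P k fun x => if x.toFinset ⊆ J then 1 else 0) = lam P J ^ k := by
  induction k with
  | zero => simp [expect_zero]
  | succ k ih =>
    rw [expect_succ, pow_succ', lam, Finset.sum_mul, ← Finset.sum_subset (Finset.subset_univ J)]
    · refine Finset.sum_congr rfl fun s hs => ?_
      rw [← lam, ← ih]
      simp [Finset.insert_subset_iff, hs]
    · intro s _ hs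
      simp [Finset.insert_subset_iff, hs, expect_const_zero]

end Expectation

section Transition

variable {B W : Type*} [Group W] {M : CoxeterMatrix B} (cs : CoxeterSystem M W) [Finite W]
  [Fintype B] (P : B → ℝ)

theorem transitionMatrix_pow_apply (k : ℕ) (β α : ReducedWord cs (longestElement cs)) :
    (transitionMatrix cs P ^ k) β α = expect P k fun x => if act cs x α = β then 1 else 0 := by
  induction k generalizing β with
  | zero => rw [pow_zero, Matrix.one_apply, expect_zero]; exact if_congr eq_comm rfl rfl
  | succ k ih =>
    rw [pow_succ', Matrix.mul_apply, expect_succ]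
    simp only [ih, transitionMatrix, Finset.sum_mul]
    rw [Finset.sum_comm]
    refine Finset.sum_congr rfl fun s _ => ?_
    have h : ∀ γ, (if exchange cs s γ = β then P s else 0) *
        (expect P k fun x => if act cs x α = γ then 1 else 0) =
        expect P k fun x => P s * ((if exchange cs s γ = β then 1 else 0) *
          if act cs x α = γ then 1 else 0) := fun γ => by
      rw [expect_const_mul, expect_const_mul]
      split_ifs <;> ring
    simp only [h]
    rw [← expect_sum, ← expect_const_mul]
    congr 1
    funext x
    rw [← Finset.mul_sum]
    simp only [mul_ite, mul_one, mul_zero, Finset.sum_ite_eq, Finset.mem_univ, if_true]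
    rfl

theorem sum_transitionMatrix_pow_mulVec (k : ℕ) (ν : ReducedWord cs (longestElement cs) → ℝ)
    (A : Finset (ReducedWord cs (longestElement cs))) :
    ∑ β ∈ A, ((transitionMatrix cs P ^ k).mulVec ν) β =
      expect P k fun x => ∑ α, ν α * if act cs x α ∈ A then 1 else 0 := by
  rw [expect_sum]
  simp only [Matrix.mulVec, dotProduct, transitionMatrix_pow_apply, expect_const_mul]
  rw [Finset.sum_comm]
  refine Finset.sum_congr rfl fun α _ => ?_
  rw [← Finset.sum_mul, ← expect_sum, mul_comm]
  simp

open Classical in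
/-- Möbius inversion on the lattice of subsets: the sum of the signs over the `J` between `K` and
`L` vanishes unless `L = K`. -/
theorem sum_multiplicity (K : Finset B) :
    ∑ J with K ⊆ J, multiplicity cs J =
      Fintype.card (ReducedWord cs (longestParabolic cs K * longestElement cs)) := by
  classical
  have hinner : ∀ L : Finset B, ∑ J with K ⊆ J ∧ J ⊆ L, (-1 : ℤ) ^ (L.card - J.card) =
      if L = K then 1 else 0 := by
    intro L
    by_cases hKL : K ⊆ L
    · have h : ∑ J with K ⊆ J ∧ J ⊆ L, (-1 : ℤ) ^ (L.card - J.card) =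
          ∑ D ∈ (L \ K).powerset, (-1 : ℤ) ^ D.card := by
        refine Finset.sum_bij' (fun J _ => L \ J) (fun D _ => L \ D) ?_ ?_ ?_ ?_ ?_
        · intro J hJ
          simp only [Finset.mem_filter, Finset.mem_univ, true_and] at hJ
          exact Finset.mem_powerset.2 (Finset.sdiff_subset_sdiff subset_rfl hJ.1)
        · intro D hD
          rw [Finset.mem_powerset] at hD
          simp only [Finset.mem_filter, Finset.mem_univ, true_and]
          refine ⟨fun s hs => ?_, Finset.sdiff_subset⟩
          rw [Finset.mem_sdiff]
          exact ⟨hKL hs, fun h => (Finset.mem_sdiff.1 (hD h)).2 hs⟩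
        · intro J hJ
          simp only [Finset.mem_filter, Finset.mem_univ, true_and] at hJ
          exact Finset.sdiff_sdiff_eq_self hJ.2
        · intro D hD
          exact Finset.sdiff_sdiff_eq_self
            ((Finset.mem_powerset.1 hD).trans Finset.sdiff_subset)
        · intro J hJ
          simp only [Finset.mem_filter, Finset.mem_univ, true_and] at hJ
          rw [Finset.card_sdiff_of_subset hJ.2]
      rw [h, Finset.sum_powerset_neg_one_pow_card]
      refine if_congr ?_ rfl rfl
      rw [Finset.sdiff_eq_empty_iff_subset]
      exact ⟨fun h => h.antisymm hKL, fun h => h.le⟩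
    · rw [if_neg fun h => hKL h.ge, Finset.filter_false_of_mem, Finset.sum_empty]
      exact fun J _ h => hKL (h.1.trans h.2)
  calc ∑ J with K ⊆ J, multiplicity cs J
      = ∑ L : Finset B, (∑ J with K ⊆ J ∧ J ⊆ L, (-1 : ℤ) ^ (L.card - J.card)) *
          (Fintype.card (ReducedWord cs (longestParabolic cs L * longestElement cs)) : ℤ) := by
        simp only [multiplicity, Finset.sum_mul]
        refine Finset.sum_comm' fun J L => ?_
        simp
    _ = _ := by simp [hinner]

/-- The trace of `T ^ k` is the expected number of reduced expressions fixed by a random word of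
length `k`, and this number depends only on the letters of the word. -/
theorem trace_transitionMatrix_pow (k : ℕ) :
    (transitionMatrix cs P ^ k).trace = ∑ J, (multiplicity cs J : ℝ) * lam P J ^ k := by
  classical
  simp only [← expect_toFinset_subset, ← expect_const_mul, ← expect_sum, Matrix.trace,
    Matrix.diag, transitionMatrix_pow_apply]
  congr 1
  funext x
  have h := sum_multiplicity cs x.toFinset
  rw [← card_act_eq_self cs x] at h
  have h' := congrArg (Int.cast : ℤ → ℝ) h
  push_cast at h'
  rw [Finset.sum_filter] at h'
  simp only [mul_ite, mul_one, mul_zero]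
  rw [h', Finset.card_filter]
  push_cast
  rfl

end Transition

/-! ### The spectrum -/

section Spectrum

variable {B W : Type*} [Group W] {M : CoxeterMatrix B} (cs : CoxeterSystem M W) [Finite W]
  [Fintype B] (P : B → ℝ)

open Classical in
theorem count_roots_charpoly (μ : ℂ) :
    (((((transitionMatrix cs P).map (fun x : ℝ => (x : ℂ))).charpoly.roots.count μ : ℕ) : ℤ)) =
      ∑ J : Finset B with (lam P J : ℂ) = μ, multiplicity cs J := by
  set T := (transitionMatrix cs P).map (fun x : ℝ => (x : ℂ))
  have hpow : ∀ k, T ^ k = (transitionMatrix cs P ^ k).map (fun x : ℝ => (x : ℂ)) := fun k =>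
    (Matrix.map_pow (transitionMatrix cs P) Complex.ofRealHom k).symm
  have h : ∀ k : ℕ, (T.charpoly.roots.map (· ^ k)).sum =
      ∑ J : Finset B, (multiplicity cs J : ℂ) * (lam P J : ℂ) ^ k := by
    intro k
    rw [← Matrix.charpoly_toLin', ← trace_pow_eq_sum_roots, ← Matrix.toLin'_pow,
      Matrix.trace_toLin'_eq, hpow]
    have h1 := congrArg (Complex.ofReal) (trace_transitionMatrix_pow cs P k)
    push_cast at h1
    rw [← h1]
    simp [Matrix.trace]
  have := count_eq_sum_of_power_sums _ _ _ h μ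
  exact_mod_cast this

/-- The multiplicities do not involve the weights of the walk, so the weights can be chosen to
make the `λ_J` distinct; powers of two do. -/
theorem multiplicity_nonneg (J : Finset B) : 0 ≤ multiplicity cs J := by
  classical
  let P : B → ℝ := fun s => 2 ^ (Fintype.equivFin B s : ℕ)
  have hinj : Function.Injective (lam P) := by
    intro J K h
    have h2 : ∀ J : Finset B, lam P J =
        ((∑ i ∈ J.image fun s => (Fintype.equivFin B s : ℕ), 2 ^ i : ℕ) : ℝ) := by
      intro J
      rw [Finset.sum_image fun s _ t _ h => (Fintype.equivFin B).injective (Fin.ext h)]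
      simp [lam, P]
    rw [h2, h2, Nat.cast_inj] at h
    exact Finset.image_injective (fun s t h => (Fintype.equivFin B).injective (Fin.ext h))
      (Finset.geomSum_injective le_rfl h)
  have h := count_roots_charpoly cs P (lam P J)
  have hJ : (Finset.univ.filter fun K : Finset B => (lam P K : ℂ) = lam P J) = {J} := by
    ext K
    simp [hinj.eq_iff]
  rw [hJ, Finset.sum_singleton] at h
  rw [← h]
  exact Int.natCast_nonneg _

theorem charpoly_transitionMatrix : (transitionMatrix cs P).charpoly =
    ∏ J : Finset B, (Polynomial.X - Polynomial.C (lam P J)) ^ (multiplicity cs J).toNat := by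
  classical
  refine Polynomial.map_injective Complex.ofRealHom Complex.ofRealHom.injective ?_
  rw [← Matrix.charpoly_map]
  simp only [Polynomial.map_prod, Polynomial.map_pow, Polynomial.map_sub, Polynomial.map_X,
    Polynomial.map_C]
  -- Two monic polynomials over `ℂ` with the same roots are equal.
  set Q : Polynomial ℂ := ∏ J : Finset B,
    (Polynomial.X - Polynomial.C (Complex.ofRealHom (lam P J))) ^ (multiplicity cs J).toNat with hQ
  have hQm : Q.Monic :=
    Polynomial.monic_prod_of_monic _ _ fun J _ => (Polynomial.monic_X_sub_C _).pow _
  have hroots : ((transitionMatrix cs P).map Complex.ofRealHom).charpoly.roots = Q.roots := by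
    ext μ
    have h := count_roots_charpoly cs P μ
    rw [← Nat.cast_inj (R := ℤ)]
    refine h.trans ?_
    rw [hQ, Polynomial.roots_prod _ _ hQm.ne_zero, Multiset.count_bind, Finset.sum_filter]
    simp only [Polynomial.roots_pow, Polynomial.roots_X_sub_C, Multiset.count_nsmul,
      Multiset.count_singleton]
    change _ = ((∑ J : Finset B, _ : ℕ) : ℤ)
    push_cast
    refine Finset.sum_congr rfl fun J _ => ?_
    simp [multiplicity_nonneg cs J, eq_comm]
  rw [(IsAlgClosed.splits _).eq_prod_roots_of_monic (Matrix.charpoly_monic _), hroots,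
    ← (IsAlgClosed.splits Q).eq_prod_roots_of_monic hQm]

theorem hasEigenvalue_transitionMatrix_iff (μ : ℂ) :
    Module.End.HasEigenvalue
      (Matrix.toLin' ((transitionMatrix cs P).map (fun x : ℝ => (x : ℂ)))) μ ↔
    ∃ J : Finset B, 0 < multiplicity cs J ∧ μ = (lam P J : ℂ) := by
  classical
  rw [Module.End.hasEigenvalue_iff_isRoot_charpoly, Matrix.charpoly_toLin',
    ← Polynomial.mem_roots (Matrix.charpoly_monic _).ne_zero, ← Multiset.count_pos,
    ← Int.natCast_pos, count_roots_charpoly,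
    Finset.sum_pos_iff_of_nonneg fun J _ => multiplicity_nonneg cs J]
  simp only [Finset.mem_filter, Finset.mem_univ, true_and]
  exact exists_congr fun J => by rw [and_comm, eq_comm]

end Spectrum

/-! ### Coalescence and convergence -/

section Convergence

open Filter Topology

variable {B W : Type*} [Group W] {M : CoxeterMatrix B} (cs : CoxeterSystem M W)
  [Fintype B] {P : B → ℝ}

open Classical in
/-- The probability that the greedy reduced subword relative to `w` of a random word of length `k`
is `β`. -/
noncomputable def greedyProb (P : B → ℝ) (k : ℕ) (w : W) (β : List B) : ℝ :=
  expect P k fun x => if greedy cs w x = β then 1 else 0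

theorem greedyProb_nonneg (hP : ∀ s, 0 < P s) (k : ℕ) (w : W) (β : List B) :
    0 ≤ greedyProb cs P k w β :=
  expect_nonneg (fun s => (hP s).le) fun x => by split_ifs <;> norm_num

theorem greedyProb_le_one (hP : ∀ s, 0 < P s) (hP1 : ∑ s, P s = 1) (k : ℕ) (w : W)
    (β : List B) : greedyProb cs P k w β ≤ 1 :=
  (expect_mono (fun s => (hP s).le) fun x => by split_ifs <;> norm_num).trans_eq
    (expect_const hP1 1 k)

/-- First step analysis: the first letter of the random word is either a right descent of `w`, and
is dropped, or has to be `t`. -/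
theorem greedyProb_succ_cons (k : ℕ) {w : W} {t : B}
    (ht : ¬ cs.IsRightDescent w t) (β : List B) :
    greedyProb cs P (k + 1) w (t :: β) =
      lam P (rightDescents cs w) * greedyProb cs P k w (t :: β) +
        P t * greedyProb cs P k (w * cs.simple t) β := by
  classical
  have h : ∀ s, (expect P k fun x => if greedy cs w (s :: x) = t :: β then 1 else 0) =
      (if cs.IsRightDescent w s then greedyProb cs P k w (t :: β) else 0) +
        if s = t then greedyProb cs P k (w * cs.simple t) β else 0 := by
    intro s
    by_cases hs : cs.IsRightDescent w s
    · have hne : s ≠ t := fun h => ht (h ▸ hs)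
      simp only [greedy_cons_of_isRightDescent cs hs, if_pos hs, if_neg hne, add_zero]
      rw [greedyProb]
    · simp only [greedy_cons_of_not_isRightDescent cs hs, if_neg hs, zero_add, List.cons.injEq]
      by_cases hst : s = t
      · subst hst
        simp [greedyProb]
      · simp only [hst, false_and, if_false]
        exact expect_const_zero k
  rw [greedyProb, expect_succ]
  simp only [h, mul_add, Finset.sum_add_distrib]
  congr 1
  · rw [lam, rightDescents, Finset.sum_filter, Finset.sum_mul]
    exact Finset.sum_congr rfl fun s _ => by split_ifs <;> simp
  · simp

theorem lam_rightDescents_lt_one (hP : ∀ s, 0 < P s) (hP1 : ∑ s, P s = 1) {w : W} {t : B}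
    (ht : ¬ cs.IsRightDescent w t) : lam P (rightDescents cs w) < 1 := by
  rw [← hP1, lam]
  exact Finset.sum_lt_sum_of_subset (Finset.subset_univ _) (Finset.mem_univ t)
    (by simpa [rightDescents] using ht) (hP t) fun s _ _ => (hP s).le

variable [Finite W]

open Classical in
/-- The probability that the Demazure product of `w` with a random word of length `k` is not yet
the longest element. -/
noncomputable def nonabsorption (P : B → ℝ) (k : ℕ) (w : W) : ℝ :=
  expect P k fun x => if demazure cs w x = longestElement cs then 0 else 1

theorem nonabsorption_succ (k : ℕ) (w : W) :
    nonabsorption cs P (k + 1) w = ∑ s, P s * nonabsorption cs P k (demR cs w s) := rfl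

theorem nonabsorption_nonneg (hP : ∀ s, 0 < P s) (k : ℕ) (w : W) :
    0 ≤ nonabsorption cs P k w :=
  expect_nonneg (fun s => (hP s).le) fun x => by split_ifs <;> norm_num

theorem nonabsorption_le_one (hP : ∀ s, 0 < P s) (hP1 : ∑ s, P s = 1) (k : ℕ) (w : W) :
    nonabsorption cs P k w ≤ 1 :=
  (expect_mono (fun s => (hP s).le) fun x => by split_ifs <;> norm_num).trans_eq
    (expect_const hP1 1 k)

/-- Away from the longest element the length of the Demazure product grows with probability at
least `p` at each step, so its expected hitting time of the longest element is at most
`(ℓ(w₀) - ℓ(w)) / p`. -/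
theorem mul_nonabsorption_le (hP : ∀ s, 0 < P s) (hP1 : ∑ s, P s = 1) {p : ℝ}
    (hp : ∀ s, p ≤ P s) (hp0 : 0 ≤ p) (k : ℕ) (w : W) :
    k * p * nonabsorption cs P k w ≤ cs.length (longestElement cs) - cs.length w := by
  have hle : ∀ w, (cs.length w : ℝ) ≤ cs.length (longestElement cs) := fun w => by
    exact_mod_cast length_le_longestElement cs w
  induction k generalizing w with
  | zero => simpa using hle w
  | succ k ih =>
    by_cases hw : w = longestElement cs
    · have h0 : nonabsorption cs P (k + 1) w = 0 := by
        rw [nonabsorption]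
        convert expect_const hP1 0 (k + 1)
        rw [if_pos]
        rw [hw]
        exact demazure_eq_self cs fun s _ => isRightDescent_longestElement cs s
      rw [h0, hw]
      simp
    · obtain ⟨t, ht⟩ : ∃ t, ¬ cs.IsRightDescent w t := by
        by_contra! h
        exact hw (eq_longestElement cs h)
      -- `h1` pays for the present step, `h2` is the induction hypothesis after one letter, and `h3`
      -- says that the expected increase in length is at least the probability of the letter `t`.
      have h1 : p * nonabsorption cs P (k + 1) w ≤ P t :=
        (mul_le_of_le_one_right hp0 (nonabsorption_le_one cs hP hP1 _ _)).trans (hp t)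
      have h2 : k * p * nonabsorption cs P (k + 1) w ≤
          ∑ s, P s * (cs.length (longestElement cs) - cs.length (demR cs w s)) := by
        rw [nonabsorption_succ, Finset.mul_sum]
        refine Finset.sum_le_sum fun s _ => ?_
        have := mul_le_mul_of_nonneg_left (ih (demR cs w s)) (hP s).le
        linarith
      have h3 : P t ≤ ∑ s, P s * (cs.length (demR cs w s) - cs.length w) := by
        have hnn : ∀ s, 0 ≤ P s * ((cs.length (demR cs w s) : ℝ) - cs.length w) := fun s => by
          refine mul_nonneg (hP s).le (sub_nonneg.2 ?_)
          rw [demR]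
          split_ifs with h
          · exact le_rfl
          · rw [cs.not_isRightDescent_iff.1 h]
            simp
        refine le_trans ?_ (Finset.single_le_sum (fun s _ => hnn s) (Finset.mem_univ t))
        rw [demR, if_neg ht, cs.not_isRightDescent_iff.1 ht]
        simp
      have h4 : ∑ s, P s * (cs.length (longestElement cs) - cs.length (demR cs w s) : ℝ) +
          ∑ s, P s * (cs.length (demR cs w s) - cs.length w : ℝ) =
          cs.length (longestElement cs) - cs.length w := by
        rw [← Finset.sum_add_distrib]
        simp only [← mul_add, sub_add_sub_cancel]
        rw [← Finset.sum_mul, hP1, one_mul]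
      push_cast
      linarith

theorem tendsto_nonabsorption (hP : ∀ s, 0 < P s) (hP1 : ∑ s, P s = 1) (w : W) :
    Tendsto (fun k => nonabsorption cs P k w) atTop (𝓝 0) := by
  obtain ⟨p, hp0, hp⟩ : ∃ p : ℝ, 0 < p ∧ ∀ s, p ≤ P s := by
    have := nonempty_of_sum_eq_one hP1
    obtain ⟨s, hs⟩ := Finite.exists_min P
    exact ⟨P s, hP s, hs⟩
  refine squeeze_zero' (Eventually.of_forall fun k => nonabsorption_nonneg cs hP k w) ?_
    (tendsto_const_div_atTop_nhds_zero_nat ((cs.length (longestElement cs) - cs.length w) / p))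
  filter_upwards [eventually_gt_atTop 0] with k hk
  have h := mul_nonabsorption_le cs hP hP1 hp hp0.le k w
  have hk' : (0 : ℝ) < k := by exact_mod_cast hk
  rw [div_div, le_div_iff₀ (by positivity)]
  linarith

theorem sum_mul_ite_mem_Icc {Ω : Type*} [Fintype Ω] {ν : Ω → ℝ} (hν : ν ∈ stdSimplex ℝ Ω)
    (p : Ω → Prop) [DecidablePred p] :
    (∑ ω, ν ω * if p ω then (1 : ℝ) else 0) ∈ Set.Icc 0 1 := by
  constructor
  · exact Finset.sum_nonneg fun ω _ => mul_nonneg (hν.1 ω) (by split_ifs <;> norm_num)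
  · refine (Finset.sum_le_sum fun ω _ => ?_).trans_eq hν.2
    exact mul_le_of_le_one_right (hν.1 ω) (by split_ifs <;> norm_num)

/-- Two initial distributions are coupled by driving both walks with the same random word: the
walks agree as soon as the Demazure product of the word is the longest element. -/
theorem abs_sum_pow_mulVec_sub_le (hP : ∀ s, 0 < P s) (k : ℕ)
    {ν μ : ReducedWord cs (longestElement cs) → ℝ} (hν : ν ∈ stdSimplex ℝ _)
    (hμ : μ ∈ stdSimplex ℝ _) (A : Finset (ReducedWord cs (longestElement cs))) :
    |∑ β ∈ A, ((transitionMatrix cs P ^ k).mulVec ν) β -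
      ∑ β ∈ A, ((transitionMatrix cs P ^ k).mulVec μ) β| ≤ nonabsorption cs P k 1 := by
  rw [sum_transitionMatrix_pow_mulVec, sum_transitionMatrix_pow_mulVec]
  refine abs_expect_sub_le (fun s => (hP s).le) fun x => ?_
  split_ifs with h
  · obtain ⟨α₀⟩ := nonempty_reducedWord cs (longestElement cs)
    have hact : ∀ α, act cs x α = act cs x α₀ := fun α => reducedWord_ext cs <| by
      rw [act_of_demazure_eq cs h, act_of_demazure_eq cs h]
    have hc : ∀ η : ReducedWord cs (longestElement cs) → ℝ, η ∈ stdSimplex ℝ _ →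
        (∑ α, η α * if act cs x α ∈ A then 1 else 0) =
          if act cs x α₀ ∈ A then (1 : ℝ) else 0 := fun η hη => by
      simp only [fun α => hact α]
      rw [← Finset.sum_mul, hη.2, one_mul]
    rw [hc ν hν, hc μ hμ, sub_self, abs_zero]
  · have h1 := sum_mul_ite_mem_Icc hν fun α => act cs x α ∈ A
    have h2 := sum_mul_ite_mem_Icc hμ fun α => act cs x α ∈ A
    rw [abs_le]
    constructor <;> linarith [h1.1, h1.2, h2.1, h2.2]

/-- When the Demazure product of the random word is the longest element, the walk is at its greedy
reduced subword. -/
theorem abs_pow_mulVec_sub_greedyProb_le (hP : ∀ s, 0 < P s) (k : ℕ)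
    {ν : ReducedWord cs (longestElement cs) → ℝ} (hν : ν ∈ stdSimplex ℝ _)
    (β : ReducedWord cs (longestElement cs)) :
    |((transitionMatrix cs P ^ k).mulVec ν) β - greedyProb cs P k 1 β.1| ≤
      nonabsorption cs P k 1 := by
  have h0 := sum_transitionMatrix_pow_mulVec cs P k ν {β}
  rw [Finset.sum_singleton] at h0
  rw [h0]
  refine abs_expect_sub_le (fun s => (hP s).le) fun x => ?_
  simp only [Finset.mem_singleton]
  split_ifs with h1 h2 h2
  · have : ∀ α, act cs x α = β := fun α => reducedWord_ext cs <| by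
      rw [act_of_demazure_eq cs h2, h1]
    simp [this, hν.2]
  · exact absurd (by rw [← wordProd_greedy_one, h1, β.2.2]) h2
  · have : ∀ α, act cs x α ≠ β := fun α h => h1 <| by
      rw [← act_of_demazure_eq cs h2 α, h]
    simp [this]
  · have h3 := sum_mul_ite_mem_Icc hν fun α => act cs x α = β
    rw [sub_zero, abs_le]
    constructor <;> linarith [h3.1, h3.2]

theorem greedyProb_longestElement_nil (hP1 : ∑ s, P s = 1) (k : ℕ) :
    greedyProb cs P k (longestElement cs) [] = 1 := by
  rw [greedyProb]
  convert expect_const hP1 1 k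
  exact if_pos ((greedy_eq_nil_iff cs).2 fun s _ => isRightDescent_longestElement cs s)

theorem monotone_greedyProb (hP : ∀ s, 0 < P s) (hP1 : ∑ s, P s = 1) {w : W} {β : List B}
    (hβ : cs.length (w * cs.wordProd β) = cs.length w + β.length)
    (hw : w * cs.wordProd β = longestElement cs) :
    Monotone fun k => greedyProb cs P k w β := by
  refine monotone_nat_of_le_succ fun k => ?_
  induction β generalizing w k with
  | nil =>
    rw [cs.wordProd_nil, mul_one] at hw
    rw [hw, greedyProb_longestElement_nil cs hP1, greedyProb_longestElement_nil cs hP1]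
  | cons t β ih =>
    obtain ⟨h1, h2⟩ := length_mul_simple_of_reduced cs hβ
    rw [cs.wordProd_cons, ← mul_assoc] at hw
    induction k with
    | zero =>
      have : greedyProb cs P 0 w (t :: β) = 0 := by
        rw [greedyProb, expect_zero, if_neg]
        simp [greedy]
      rw [this]
      exact greedyProb_nonneg cs hP _ _ _
    | succ k ihk =>
      rw [greedyProb_succ_cons cs k h1, greedyProb_succ_cons cs (k + 1) h1]
      gcongr
      · exact Finset.sum_nonneg fun s _ => (hP s).le
      · exact (hP t).le
      · exact ih h2 hw k

theorem tendsto_greedyProb (hP : ∀ s, 0 < P s) (hP1 : ∑ s, P s = 1) {w : W} {β : List B}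
    (hβ : cs.length (w * cs.wordProd β) = cs.length w + β.length)
    (hw : w * cs.wordProd β = longestElement cs) :
    Tendsto (fun k => greedyProb cs P k w β) atTop (𝓝 (∏ i : Fin β.length,
      P (β.get i) / (1 - lam P (rightDescents cs (w * cs.wordProd (β.take i)))))) := by
  induction β generalizing w with
  | nil =>
    rw [cs.wordProd_nil, mul_one] at hw
    rw [hw]
    simp [greedyProb_longestElement_nil cs hP1]
  | cons t β ih =>
    obtain ⟨L, hL⟩ : ∃ L, Tendsto (fun k => greedyProb cs P k w (t :: β)) atTop (𝓝 L) :=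
      ⟨_, tendsto_atTop_ciSup (monotone_greedyProb cs hP hP1 hβ hw)
        ⟨1, by rintro _ ⟨k, rfl⟩; exact greedyProb_le_one cs hP hP1 k w _⟩⟩
    obtain ⟨h1, h2⟩ := length_mul_simple_of_reduced cs hβ
    rw [cs.wordProd_cons, ← mul_assoc] at hw
    have hlt := lam_rightDescents_lt_one cs hP hP1 h1
    have hrec := (hL.const_mul (lam P (rightDescents cs w))).add ((ih h2 hw).const_mul (P t))
    have hL' := (tendsto_add_atTop_iff_nat 1).2 hL
    simp only [greedyProb_succ_cons cs _ h1] at hL'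
    have he := tendsto_nhds_unique hL' hrec
    convert hL
    refine (Fin.prod_univ_succ (n := β.length) _).trans ?_
    simp only [List.get_eq_getElem, Fin.val_zero, List.getElem_cons_zero, List.take_zero,
      cs.wordProd_nil, mul_one, Fin.val_succ, List.getElem_cons_succ, List.take_succ_cons,
      cs.wordProd_cons, ← mul_assoc]
    simp only [List.get_eq_getElem] at he
    rw [div_mul_eq_mul_div, div_eq_iff (by linarith)]
    linarith

end Convergence

/-! ### The stationary distribution and the mixing time -/

section Stationary

open Filter Topology

variable {B W : Type*} [Group W] {M : CoxeterMatrix B} (cs : CoxeterSystem M W) [Finite W]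
  [Fintype B] {P : B → ℝ}

theorem transitionMatrix_mem_colStochastic (hP : ∀ s, 0 < P s) (hP1 : ∑ s, P s = 1) :
    transitionMatrix cs P ∈ Matrix.colStochastic ℝ (ReducedWord cs (longestElement cs)) := by
  rw [Matrix.mem_colStochastic_iff_sum]
  constructor
  · intro β α
    exact Finset.sum_nonneg fun s _ => by
      split_ifs
      · exact (hP s).le
      · exact le_rfl
  · intro α
    simp only [transitionMatrix]
    rw [Finset.sum_comm]
    simpa using hP1

theorem isErgodic_transitionMatrix (hP : ∀ s, 0 < P s) (hP1 : ∑ s, P s = 1) :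
    IsErgodic (transitionMatrix cs P) := by
  refine ⟨transitionMatrix_mem_colStochastic cs hP hP1, cs.length (longestElement cs),
    fun β α => ?_⟩
  have hlen : cs.length (longestElement cs) = β.1.length := by rw [← β.2.1.eq, β.2.2]
  rw [transitionMatrix_pow_apply, hlen]
  refine expect_pos hP (fun x => by split_ifs <;> norm_num) ?_
  rw [if_pos (act_self cs β α)]
  exact one_pos

theorem pow_mulVec_mem_stdSimplex (hP : ∀ s, 0 < P s) (hP1 : ∑ s, P s = 1) (k : ℕ)
    {ν : ReducedWord cs (longestElement cs) → ℝ} (hν : ν ∈ stdSimplex ℝ _) :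
    (transitionMatrix cs P ^ k).mulVec ν ∈ stdSimplex ℝ _ := by
  have hk := pow_mem (transitionMatrix_mem_colStochastic cs hP hP1) k
  refine ⟨Matrix.nonneg_mulVec_of_mem_colStochastic hk hν.1, ?_⟩
  have := Matrix.mulVec_dotProduct_one_eq_one_colStochastic hk (x := ν)
    (by simpa [dotProduct] using hν.2)
  simpa [dotProduct] using this

theorem tendsto_pow_mulVec (hP : ∀ s, 0 < P s) (hP1 : ∑ s, P s = 1)
    {ν : ReducedWord cs (longestElement cs) → ℝ} (hν : ν ∈ stdSimplex ℝ _) :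
    Tendsto (fun k => (transitionMatrix cs P ^ k).mulVec ν) atTop
      (𝓝 (stationaryProduct cs P)) := by
  rw [tendsto_pi_nhds]
  intro β
  have h1 : Tendsto (fun k => greedyProb cs P k 1 β.1) atTop (𝓝 (stationaryProduct cs P β)) := by
    have := tendsto_greedyProb cs hP hP1 (w := 1) (β := β.1) (by simpa using β.2.1.eq)
      (by rw [one_mul, β.2.2])
    simp only [one_mul] at this
    exact this
  have h2 : Tendsto (fun k => ((transitionMatrix cs P ^ k).mulVec ν) β -
      greedyProb cs P k 1 β.1) atTop (𝓝 0) :=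
    squeeze_zero_norm (fun k => abs_pow_mulVec_sub_greedyProb_le cs hP k hν β)
      (tendsto_nonabsorption cs hP hP1 1)
  simpa using h2.add h1

/-- The limit of `T ^ k ν` is a probability distribution fixed by `T`. -/
theorem isStationary_stationaryProduct (hP : ∀ s, 0 < P s) (hP1 : ∑ s, P s = 1) :
    IsStationary (transitionMatrix cs P) (stationaryProduct cs P) := by
  obtain ⟨α₀⟩ := nonempty_reducedWord cs (longestElement cs)
  have h := tendsto_pow_mulVec cs hP hP1 (single_mem_stdSimplex ℝ α₀)
  refine ⟨(isClosed_stdSimplex ℝ _).mem_of_tendsto h (Eventually.of_forall fun k =>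
    pow_mulVec_mem_stdSimplex cs hP hP1 k (single_mem_stdSimplex ℝ α₀)), ?_⟩
  have h1 := (tendsto_add_atTop_iff_nat 1).2 h
  have h2 : Tendsto (fun k => (transitionMatrix cs P).mulVec
      ((transitionMatrix cs P ^ k).mulVec (Pi.single α₀ 1))) atTop
      (𝓝 ((transitionMatrix cs P).mulVec (stationaryProduct cs P))) :=
    ((Continuous.matrix_mulVec continuous_const continuous_id).tendsto _).comp h
  simp only [Matrix.mulVec_mulVec, ← pow_succ'] at h2
  exact tendsto_nhds_unique h2 h1

theorem pow_mulVec_of_isStationary {Ω : Type*} [Fintype Ω] [DecidableEq Ω] {T : Matrix Ω Ω ℝ}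
    {π : Ω → ℝ} (h : IsStationary T π) (k : ℕ) : (T ^ k).mulVec π = π := by
  induction k with
  | zero => simp
  | succ k ih => rw [pow_succ, ← Matrix.mulVec_mulVec, h.2, ih]

theorem eq_stationaryProduct (hP : ∀ s, 0 < P s) (hP1 : ∑ s, P s = 1)
    {ν : ReducedWord cs (longestElement cs) → ℝ} (hν : IsStationary (transitionMatrix cs P) ν) :
    ν = stationaryProduct cs P := by
  have h := tendsto_pow_mulVec cs hP hP1 hν.1
  simp only [pow_mulVec_of_isStationary hν] at h
  exact tendsto_nhds_unique tendsto_const_nhds h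

theorem distToStationary_le (hP : ∀ s, 0 < P s) (hP1 : ∑ s, P s = 1) (k : ℕ) :
    distToStationary (transitionMatrix cs P) (stationaryProduct cs P) k ≤
      nonabsorption cs P k 1 := by
  have hπ := isStationary_stationaryProduct cs hP hP1
  have : Nonempty (stdSimplex ℝ (ReducedWord cs (longestElement cs))) := ⟨⟨_, hπ.1⟩⟩
  refine ciSup_le fun ν => Finset.sup'_le _ _ fun A _ => ?_
  have h := abs_sum_pow_mulVec_sub_le cs hP k ν.2 hπ.1 A
  rwa [pow_mulVec_of_isStationary hπ] at h

theorem mem_mixedTimes (hP : ∀ s, 0 < P s) (hP1 : ∑ s, P s = 1) {p : ℝ} (hp0 : 0 < p)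
    (hp : ∀ s, p ≤ P s) {ε : ℝ} (hε : 0 < ε) {k : ℕ}
    (hk : cs.length (longestElement cs) / (p * ε) ≤ k) :
    k ∈ mixedTimes (transitionMatrix cs P) (stationaryProduct cs P) ε := by
  refine (distToStationary_le cs hP hP1 k).trans ?_
  have h := mul_nonabsorption_le cs hP hP1 hp hp0.le k 1
  rw [cs.length_one, Nat.cast_zero, sub_zero] at h
  rw [div_le_iff₀ (by positivity)] at hk
  have hlen : 0 < cs.length (longestElement cs) := by
    have := nonempty_of_sum_eq_one hP1
    exact (Nat.zero_le _).trans_lt (isLeftDescent_longestElement cs (Classical.arbitrary B))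
  have hk0 : (0 : ℝ) < k := by
    rcases Nat.eq_zero_or_pos k with rfl | h
    · rw [Nat.cast_zero, zero_mul] at hk
      have : (0 : ℝ) < cs.length (longestElement cs) := by exact_mod_cast hlen
      linarith
    · exact_mod_cast h
  have : k * p * nonabsorption cs P k 1 ≤ k * p * ε := by linarith
  exact le_of_mul_le_mul_left this (by positivity)

theorem mixingTime_le (hP : ∀ s, 0 < P s) (hP1 : ∑ s, P s = 1) {p : ℝ} (hp0 : 0 < p)
    (hp : ∀ s, p ≤ P s) {ε : ℝ} (hε : 0 < ε) :
    (mixingTime (transitionMatrix cs P) (stationaryProduct cs P) ε : ℝ) ≤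
      (1 / ε + 1) * (cs.length (longestElement cs) / p) := by
  have := nonempty_of_sum_eq_one hP1
  have hlen : (1 : ℝ) ≤ cs.length (longestElement cs) := by
    exact_mod_cast (Nat.zero_le _).trans_lt
      (isLeftDescent_longestElement cs (Classical.arbitrary B))
  have hp1 : p ≤ 1 := by
    rw [← hP1]
    exact (hp (Classical.arbitrary B)).trans
      (Finset.single_le_sum (fun s _ => (hP s).le) (Finset.mem_univ _))
  have h1 : mixingTime (transitionMatrix cs P) (stationaryProduct cs P) ε ≤
      ⌈cs.length (longestElement cs) / (p * ε)⌉₊ :=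
    Nat.sInf_le (mem_mixedTimes cs hP hP1 hp0 hp hε (Nat.le_ceil _))
  calc (mixingTime (transitionMatrix cs P) (stationaryProduct cs P) ε : ℝ)
      ≤ ⌈cs.length (longestElement cs) / (p * ε)⌉₊ := by exact_mod_cast h1
    _ ≤ cs.length (longestElement cs) / (p * ε) + 1 := (Nat.ceil_lt_add_one (by positivity)).le
    _ ≤ cs.length (longestElement cs) / (p * ε) + cs.length (longestElement cs) / p := by
        gcongr
        rw [le_div_iff₀ hp0]
        linarith
    _ = (1 / ε + 1) * (cs.length (longestElement cs) / p) := by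
        field_simp

end Stationary

end ExchangeWalk

open ExchangeWalk in
theorem mainTheorem2 :
    ∃ C : ℝ → ℝ, ∀ (B : Type*) [Fintype B] (W : Type*) [Group W] [Finite W]
      (M : CoxeterMatrix B) (cs : CoxeterSystem M W) (P : B → ℝ),
      (∀ s, 0 < P s) → ∑ s, P s = 1 →
      -- the exchange walk is an ergodic Markov chain
      IsErgodic (transitionMatrix cs P) ∧
      -- the eigenvalues are the `λ_J`, where a `λ_J` of multiplicity zero is to be disregarded
      (∀ μ : ℂ,
        Module.End.HasEigenvalue
          (Matrix.toLin' ((transitionMatrix cs P).map (fun x : ℝ => (x : ℂ)))) μ ↔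
        ∃ J : Finset B, 0 < multiplicity cs J ∧ μ = (lam P J : ℂ)) ∧
      -- the (algebraic) multiplicities
      (∀ J : Finset B, 0 ≤ multiplicity cs J) ∧
      (transitionMatrix cs P).charpoly =
        ∏ J : Finset B,
          (Polynomial.X - Polynomial.C (lam P J)) ^ (multiplicity cs J).toNat ∧
      -- the unique stationary distribution
      IsStationary (transitionMatrix cs P) (stationaryProduct cs P) ∧
      (∀ ν, IsStationary (transitionMatrix cs P) ν → ν = stationaryProduct cs P) ∧
      -- the mixing time
      ∀ ε : ℝ, 0 < ε →
        (mixedTimes (transitionMatrix cs P) (stationaryProduct cs P) ε).Nonempty ∧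
        (mixingTime (transitionMatrix cs P) (stationaryProduct cs P) ε : ℝ) ≤
          C ε * (cs.length (longestElement cs) / ⨅ s, P s) ∧
        ((∀ s, P s = 1 / Fintype.card B) →
          (mixingTime (transitionMatrix cs P) (stationaryProduct cs P) ε : ℝ) ≤
            C ε * (cs.length (longestElement cs) * Fintype.card B)) := by
  refine ⟨fun ε => 1 / ε + 1, fun B _ W _ _ M cs P hP hP1 => ?_⟩
  have := nonempty_of_sum_eq_one hP1
  have hp : ∀ s, ⨅ s, P s ≤ P s := fun s => ciInf_le (Set.finite_range P).bddBelow s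
  have hp0 : 0 < ⨅ s, P s := by
    obtain ⟨s, hs⟩ := exists_eq_ciInf_of_finite (f := P)
    exact hs ▸ hP s
  refine ⟨isErgodic_transitionMatrix cs hP hP1, hasEigenvalue_transitionMatrix_iff cs P,
    multiplicity_nonneg cs, charpoly_transitionMatrix cs P,
    isStationary_stationaryProduct cs hP hP1, fun ν hν => eq_stationaryProduct cs hP hP1 hν,
    fun ε hε => ⟨⟨_, mem_mixedTimes cs hP hP1 hp0 hp hε (Nat.le_ceil _)⟩,
      mixingTime_le cs hP hP1 hp0 hp hε, fun hU => ?_⟩⟩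
  have h := mixingTime_le cs hP hP1 (p := 1 / Fintype.card B) (by positivity)
    (fun s => (hU s).ge) hε
  rwa [div_div_eq_mul_div, div_one] at h
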